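/- **Setting.** A unit is $(X,Y(1),Y(0),D,R)\sim Q$ with $X\in\mathbb R^k$, real potential outcomes, treatment $D\in\{0,1\}$ and response $R\in\{0,1\}$ ($R=0$: attrition); $Y^{\rm obs}=Y(D)$. Assume (1) $(Y(1),Y(0))\perp D\mid X$; (2) $(Y(1),Y(0))\perp R\mid X,D$; (3) for some $c>0$, almost surely $c<P(D=1\mid X)<1-c$ and $c<e_R<1-c$, where $e_R=P(R=1\mid X,D)$. Put $\pi_R=e_R/(1-e_R)$. On training data the following measurable functions are learned: intervals $\mathcal C_d(x)=[l_d(x),u_d(x)]$ for $Y(d)$, regressions $\hat h^L,\hat h^R$, and estimators $\hat m_{\mathcal C}(\eta,x,d)$ and $\hat\pi_R(x,d)$. Let $\mathcal C_{\rm ITE}=[\mathcal C^L,\mathcal C^R]$ be $Y^{\rm obs}-\mathcal C_0(X)$ if $D=1$ and $\mathcal C_1(X)-Y^{\rm obs}$ if $D=0$, let $V_{\mathcal C}=\max\{\hat h^L(X)-\mathcal C^L,\ \mathcal C^R-\hat h^R(X)\}$, and let $m_{\mathcal C}(\eta,X,D)=P(V_{\mathcal C}<\eta\mid X,D,R=1)$.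 For $\gamma\in(0,1)$ put $$\psi(\eta)=(1-R)\bigl[\hat m_{\mathcal C}(\eta,X,D)-(1-\gamma)\bigr]+\frac{R}{\hat\pi_R(X,D)}\bigl[\mathbf 1\{V_{\mathcal C}<\eta\}-\hat m_{\mathcal C}(\eta,X,D)\bigr].$$ Given a calibration sample $\mathcal I_2$ of $N=|\mathcal I_2|\ge1$ i.i.d. units with law $Q$, independent of the training data, let $\hat\eta\in[-\infty,\infty]$ be the smallest $\eta$ (the infimum of all $\eta\in\mathbb R$) with $\frac1N\sum_{i\in\mathcal I_2}\psi_i(\eta)\ge0$, assumed to be a measurable function of the data, and let $\check{\mathcal C}(x)=[\hat h^L(x)-\hat\eta,\hat h^R(x)+\hat\eta]$. Assume that $|\hat m_{\mathcal C}|\le m_0$, that $|\hat\pi_R|\ge\pi_0$ with $0<\pi_0\le1$, and that $\hat m_{\mathcal C}$ is non-decreasing in $\eta$. Below, probabilities given $R=0$ and the norms $\|\cdot\|_2=\|\cdot\|_{L^2(Q)}$ refer to a fresh unit, with the training and calibration data held fixed. **Theorem.** There are universal constants $C_0,C_1>0$ such that, for every $\delta>0$, with $$\Delta=\frac{C_0\,\pi_0^{-1}(1+m_0)}{P(R=0)}\sqrt{\frac{\log(1/\delta)+1}{|\mathcal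 I_2|}}+\frac{C_1\,\pi_0^{-1}}{P(R=0)}\,\|\hat\pi_R-\pi_R\|_2\cdot\sup_{\eta\in\mathbb R}\|\hat m_{\mathcal C}(\eta,\cdot)-m_{\mathcal C}(\eta,\cdot)\|_2 ,$$ each of the following holds with probability at least $1-\delta$ over the training and calibration data: (a) $P(V_{\mathcal C}<\hat\eta\mid R=0)\ge1-\gamma-\Delta$, provided that the smallest solution $\hat\eta$ is almost surely attained or that the law of $V_{\mathcal C}$ given $R=0$ has no atoms for almost every realization of the training data; (b) $P(\mathcal C_{\rm ITE}\subseteq\check{\mathcal C}(X)\mid R=0)\ge1-\gamma-\Delta$; (c) $P(Y(1)-Y(0)\in\check{\mathcal C}(X)\mid R=0)\ge 1-\bigl(P(Y(1)-Y(0)\notin\mathcal C_{\rm ITE}\mid R=0)+\gamma\bigr)-\Delta$. Consequently, along a sequence of such procedures with $Q,\gamma,m_0,\pi_0$ fixed and $|\mathcal I_2|\to\infty$: if the first-step intervals have asymptotic level $1-\alpha$ in the attrition group for some $\alpha\in(0,1)$, that is $P(Y(1)-Y(0)\notin\mathcal C_{\rm ITE}\mid R=0)\le\alpha+o_p(1)$,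 and $\|\hat\pi_R-\pi_R\|_2\cdot\sup_\eta\|\hat m_{\mathcal C}(\eta,\cdot)-m_{\mathcal C}(\eta,\cdot)\|_2=o_p(1)$, then $$P(Y(1)-Y(0)\in\check{\mathcal C}(X)\mid R=0)\ge1-(\alpha+\gamma)-o_p(1).$$ -/

import Mathlib

open MeasureTheory ProbabilityTheory Filter
open scoped ENNReal Topology

noncomputable section

namespace Attrition

/-- Covariate space `ℝ^k`. -/
abbrev Cov (k : ℕ) := EuclideanSpace ℝ (Fin k)

/-- A unit `(X, Y(1), Y(0), D, R)`; for `D` and `R` the value `true` stands for `1`. -/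
abbrev Obs (k : ℕ) := Cov k × ℝ × ℝ × Bool × Bool

variable {k : ℕ}

/-- Covariates. -/
def X (o : Obs k) : Cov k := o.1

/-- Potential outcome under treatment. -/
def Y1 (o : Obs k) : ℝ := o.2.1

/-- Potential outcome under control. -/
def Y0 (o : Obs k) : ℝ := o.2.2.1

/-- Treatment indicator. -/
def D (o : Obs k) : Bool := o.2.2.2.1

/-- Response indicator: `false` means attrition. -/
def R (o : Obs k) : Bool := o.2.2.2.2

/-- The outcome under the received treatment (recorded only if `R = 1`). -/
def Yobs (o : Obs k) : ℝ := if D o then Y1 o else Y0 o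

/-- The individual treatment effect. -/
def effect (o : Obs k) : ℝ := Y1 o - Y0 o

/-- The pair of potential outcomes. -/
def potential (o : Obs k) : ℝ × ℝ := (Y1 o, Y0 o)

/-- Covariates together with treatment. -/
def XD (o : Obs k) : Cov k × Bool := (X o, D o)

lemma measurable_X : Measurable (X (k := k)) := measurable_fst

lemma measurable_XD : Measurable (XD (k := k)) :=
  measurable_fst.prodMk (measurable_fst.comp
    (measurable_snd.comp (measurable_snd.comp measurable_snd)))

/-- The σ-algebra generated by `X`. -/
@[reducible] def sigmaX (k : ℕ) : MeasurableSpace (Obs k) := MeasurableSpace.comap X inferInstance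

/-- The σ-algebra generated by `(X, D)`. -/
@[reducible] def sigmaXD (k : ℕ) : MeasurableSpace (Obs k) := MeasurableSpace.comap XD inferInstance

lemma sigmaX_le : sigmaX k ≤ (inferInstance : MeasurableSpace (Obs k)) :=
  measurable_X.comap_le

lemma sigmaXD_le : sigmaXD k ≤ (inferInstance : MeasurableSpace (Obs k)) :=
  measurable_XD.comap_le

/-- Unconfoundedness: `(Y(1), Y(0)) ⫫ D | X`. -/
def Unconfounded (Q : Measure (Obs k)) [IsFiniteMeasure Q] : Prop :=
  CondIndepFun (sigmaX k) sigmaX_le potential D Q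

/-- Missingness at random: `(Y(1), Y(0)) ⫫ R | X, D`. -/
def MissingAtRandom (Q : Measure (Obs k)) [IsFiniteMeasure Q] : Prop :=
  CondIndepFun (sigmaXD k) sigmaXD_le potential R Q

/-- Treatment propensity `e_D(X) = P(D = 1 | X)`. -/
def eD (Q : Measure (Obs k)) : Obs k → ℝ :=
  Q[Set.indicator {o | D o = true} (fun _ => (1 : ℝ)) | sigmaX k]

/-- Response propensity `e_R(X, D) = P(R = 1 | X, D)`. -/
def eR (Q : Measure (Obs k)) : Obs k → ℝ :=
  Q[Set.indicator {o | R o = true} (fun _ => (1 : ℝ)) | sigmaXD k]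

/-- Overlap for both propensities. -/
def Overlap (Q : Measure (Obs k)) : Prop :=
  ∃ c : ℝ, 0 < c ∧ (∀ᵐ o ∂Q, c < eD Q o ∧ eD Q o < 1 - c) ∧
    ∀ᵐ o ∂Q, c < eR Q o ∧ eR Q o < 1 - c

/-- The law of a unit given `R = 0`. -/
def attrited (Q : Measure (Obs k)) : Measure (Obs k) := ProbabilityTheory.cond Q {o | R o = false}

/-- The law of a unit given `R = 1`. -/
def responding (Q : Measure (Obs k)) : Measure (Obs k) := ProbabilityTheory.cond Q {o | R o = true}

/-- `P(R = 0)`. -/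
def probAttrition (Q : Measure (Obs k)) : ℝ := Q.real {o | R o = false}

/-- The odds `π_R(X, D) = P(R = 1 | X, D) / P(R = 0 | X, D)`. -/
def piR (Q : Measure (Obs k)) (o : Obs k) : ℝ := eR Q o / (1 - eR Q o)

/-- Everything that is learned on the training fold: the endpoints of the counterfactual intervals
`C_d(x) = [lower d x, upper d x]`, the endpoint regressions `ĥ^L, ĥ^R`, the estimate `m̂_C(η, x, d)`
of the conditional distribution function of the score, and the estimate `π̂_R(x, d)` of the odds. -/
structure Fit (k : ℕ) where
  lower : Bool → Cov k → ℝ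
  upper : Bool → Cov k → ℝ
  hL : Cov k → ℝ
  hR : Cov k → ℝ
  mHat : ℝ → Cov k → Bool → ℝ
  piHat : Cov k → Bool → ℝ

namespace Fit

variable (F : Fit k)

/-- Left endpoint of the surrogate interval `C_ITE`, which is `Y^obs - C_0(X)` if `D = 1` and
`C_1(X) - Y^obs` if `D = 0`. -/
def cL (o : Obs k) : ℝ :=
  if D o then Yobs o - F.upper false (X o) else F.lower true (X o) - Yobs o

/-- Right endpoint of the surrogate interval `C_ITE`. -/
def cR (o : Obs k) : ℝ :=
  if D o then Yobs o - F.lower false (X o) else F.upper true (X o) - Yobs o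

/-- The surrogate interval `C_ITE(X; D, Y^obs)`. -/
def surrogate (o : Obs k) : Set ℝ := Set.Icc (F.cL o) (F.cR o)

/-- The nonconformity score `V_C`. -/
def score (o : Obs k) : ℝ := max (F.hL (X o) - F.cL o) (F.cR o - F.hR (X o))

/-- The interval `[ĥ^L(x) - η, ĥ^R(x) + η]` of reals, for a threshold `η ∈ [-∞, ∞]`
(all of `ℝ` for `η = ∞`, empty for `η = -∞`). -/
def expanded (η : EReal) (x : Cov k) : Set ℝ :=
  {y : ℝ | ((F.hL x - y : ℝ) : EReal) ≤ η ∧ ((y - F.hR x : ℝ) : EReal) ≤ η}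

open Classical in
/-- The estimated influence function `ψ_C(η; m̂_C, π̂_R)` at level `γ`. -/
def psi (γ η : ℝ) (o : Obs k) : ℝ :=
  (1 - (if R o then 1 else 0)) * (F.mHat η (X o) (D o) - (1 - γ))
    + (if R o then 1 else 0) / F.piHat (X o) (D o)
      * ((if F.score o < η then 1 else 0) - F.mHat η (X o) (D o))

/-- The thresholds that satisfy the sample moment condition on a calibration sample. -/
def solutions (γ : ℝ) {N : ℕ} (s : Fin N → Obs k) : Set ℝ :=
  {η : ℝ | 0 ≤ (1 / (N : ℝ)) * ∑ i, F.psi γ η (s i)}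

/-- The threshold `η̂`: the smallest solution, understood as the infimum in `[-∞, ∞]` (the set of
solutions need not contain its infimum, since `η ↦ 1{V < η}` is only left continuous). -/
def etaHat (γ : ℝ) {N : ℕ} (s : Fin N → Obs k) : EReal :=
  sInf ((fun η : ℝ => (η : EReal)) '' F.solutions γ s)

/-- The smallest solution exists as a real number. -/
def Attained (γ : ℝ) {N : ℕ} (s : Fin N → Obs k) : Prop :=
  ∃ η : ℝ, IsLeast (F.solutions γ s) η

/-- The true conditional distribution function `m_C(η, X, D) = P(V_C < η | X, D, R = 1)`. -/
def mC (Q : Measure (Obs k)) (η : ℝ) : Obs k → ℝ :=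
  (responding Q)[Set.indicator {o | F.score o < η} (fun _ => (1 : ℝ)) | sigmaXD k]

/-- `‖π̂_R(X, D) - π_R(X, D)‖₂`. -/
def piError (Q : Measure (Obs k)) : ℝ≥0∞ :=
  eLpNorm (fun o => F.piHat (X o) (D o) - piR Q o) 2 Q

/-- `sup_η ‖m̂_C(η, X, D) - m_C(η, X, D)‖₂`. -/
def mError (Q : Measure (Obs k)) : ℝ≥0∞ :=
  ⨆ η : ℝ, eLpNorm (fun o => F.mHat η (X o) (D o) - F.mC Q η o) 2 Q

/-- `m̂_C` is bounded by `m₀` and non-decreasing in `η`, and `|π̂_R|` is at least `π₀`. -/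
structure Regular (m₀ π₀ : ℝ) : Prop where
  bound : ∀ η x d, |F.mHat η x d| ≤ m₀
  lower : ∀ x d, π₀ ≤ |F.piHat x d|
  mono : ∀ x d, Monotone fun η => F.mHat η x d

/-- `P(V_C < η | R = 0)`. -/
def coverage (Q : Measure (Obs k)) (η : EReal) : ℝ≥0∞ :=
  attrited Q {o | (F.score o : EReal) < η}

/-- `P(C_ITE ⊆ [ĥ^L(X) - η, ĥ^R(X) + η] | R = 0)`. -/
def containment (Q : Measure (Obs k)) (η : EReal) : ℝ≥0∞ :=
  attrited Q {o | F.surrogate o ⊆ F.expanded η (X o)}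

/-- `P(Y(1) - Y(0) ∈ [ĥ^L(X) - η, ĥ^R(X) + η] | R = 0)`. -/
def iteCoverage (Q : Measure (Obs k)) (η : EReal) : ℝ≥0∞ :=
  attrited Q {o | effect o ∈ F.expanded η (X o)}

/-- `P(Y(1) - Y(0) ∉ C_ITE | R = 0)`. -/
def surrogateMiss (Q : Measure (Obs k)) : ℝ≥0∞ :=
  attrited Q {o | effect o ∉ F.surrogate o}

/-- The law of the score given `R = 0` has no atoms. -/
def Atomless (Q : Measure (Obs k)) : Prop :=
  ∀ v : ℝ, attrited Q {o | F.score o = v} = 0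

/-- The sampling error
`C₀ π₀⁻¹ (1 + m₀) / P(R = 0) * √((log (1 / δ) + 1) / N)`. -/
def _root_.Attrition.samplingError (Q : Measure (Obs k)) (C₀ m₀ π₀ δ : ℝ) (N : ℕ) : ℝ :=
  C₀ * (π₀⁻¹ * (1 + m₀) / probAttrition Q) * Real.sqrt ((Real.log (1 / δ) + 1) / N)

/-- The product error `C₁ π₀⁻¹ / P(R = 0) * ‖π̂_R - π_R‖₂ * sup_η ‖m̂_C - m_C‖₂`. -/
def productError (Q : Measure (Obs k)) (C₁ π₀ : ℝ) : ℝ≥0∞ :=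
  ENNReal.ofReal (C₁ * π₀⁻¹ / probAttrition Q) * (F.piError Q * F.mError Q)

end Fit

/-- A learning rule on training data in `𝒯` all of whose outputs are jointly measurable in the
training data and their arguments. -/
structure MeasurableFit {𝒯 : Type*} [MeasurableSpace 𝒯] (L : 𝒯 → Fit k) : Prop where
  lower : ∀ d, Measurable fun p : 𝒯 × Cov k => (L p.1).lower d p.2
  upper : ∀ d, Measurable fun p : 𝒯 × Cov k => (L p.1).upper d p.2
  hL : Measurable fun p : 𝒯 × Cov k => (L p.1).hL p.2
  hR : Measurable fun p : 𝒯 × Cov k => (L p.1).hR p.2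
  mHat : ∀ d, Measurable fun p : 𝒯 × ℝ × Cov k => (L p.1).mHat p.2.1 p.2.2 d
  piHat : ∀ d, Measurable fun p : 𝒯 × Cov k => (L p.1).piHat p.2 d

/-- The joint law of the training data (law `τ`) and of an independent calibration sample of `N`
independent units with law `Q`. -/
def dataLaw {𝒯 : Type*} [MeasurableSpace 𝒯] (τ : Measure 𝒯) (Q : Measure (Obs k)) (N : ℕ) :
    Measure (𝒯 × (Fin N → Obs k)) :=
  τ.prod (Measure.pi fun _ => Q)

end Attrition

end

/-! The moment `psi` is doubly robust. Under missingness at random and overlap, its mean at η is P(V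
< η, R = 0) − (1 − γ) P(R = 0) plus the bias ∫ (1 − e_R) π̂⁻¹ (m̂ − m)(π̂ − π)
(`Fit.Regular.integral_psi`), and Cauchy–Schwarz bounds the bias by π₀⁻¹ times the product of the
two L² errors. Hence any threshold whose mean moment is at least −u, however it was chosen, covers
attrited units with probability at least 1 − γ up to u / P(R = 0) and the product error.

Since η̂ depends on the data, sample moments must be close to their means uniformly in η. `psi` is,
up to affine scaling, a signed combination of five families that are non-decreasing in η with values
in [0, 1]. For such a family the uniform deviation is sub-Gaussian with no logarithm of N
(`pi_exists_abs_deviation_le`): symmetrization and a level-set decomposition reduce it to sums of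
random signs along nested index sets; their exponentials form a submartingale, and Doob's L²
inequality costs only a factor 4.

The infimum η̂ needs care. If it is a solution, its mean moment is at least −u. Otherwise solutions
accumulate at it from above, or run to −∞; the mean moment has a limit there, again at least −u, and
P(V < η | R = 0) tends to P(V ≤ η̂ | R = 0). This closed coverage suffices for (b), and for (c) by a
union bound; (a) needs attainment or the absence of atoms. For the asymptotic claim, δ is fixed
while N grows. -/

namespace Attrition

/-! ### Maximal inequalities for random signs -/

section Rademacher

/-- The pathwise form of Doob's `L²` maximal inequality. -/
lemma partialSups_sq_le (x : ℕ → ℝ) (n : ℕ) :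
    (partialSups x n) ^ 2 / 2 ≤ x n * partialSups x n
      - ∑ j ∈ Finset.range n, partialSups x j * (x (j + 1) - x j) := by
  induction n with
  | zero => simp; nlinarith [sq_nonneg (x 0)]
  | succ n ih =>
    rw [Finset.sum_range_succ, partialSups_add_one]
    -- When the maximum does not move, the right side does not change either; when it jumps, the
    -- slack is half the square of the jump.
    rcases le_total (partialSups x n) (x (n + 1)) with h | h
    · rw [sup_eq_right.2 h]
      nlinarith [sq_nonneg (x (n + 1) - partialSups x n)]
    · rw [sup_eq_left.2 h]
      nlinarith

/-- The sign `±1` coded by a Boolean. -/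
noncomputable def sgn (b : Bool) : ℝ := if b then 1 else -1

lemma sgn_not (b : Bool) : sgn (!b) = -sgn b := by cases b <;> simp [sgn]

lemma abs_sgn (b : Bool) : |sgn b| = 1 := by cases b <;> simp [sgn]

variable {N : ℕ}

/-- Flipping all signs outside of `A`. -/
def flipOutside (A : Finset (Fin N)) : (Fin N → Bool) ≃ (Fin N → Bool) where
  toFun ε i := if i ∈ A then ε i else !ε i
  invFun ε i := if i ∈ A then ε i else !ε i
  left_inv ε := by ext i; by_cases h : i ∈ A <;> simp [h]
  right_inv ε := by ext i; by_cases h : i ∈ A <;> simp [h]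

lemma sum_sgn_flipOutside_of_subset {A B : Finset (Fin N)} (h : B ⊆ A) (ε : Fin N → Bool) :
    ∑ i ∈ B, sgn (flipOutside A ε i) = ∑ i ∈ B, sgn (ε i) :=
  Finset.sum_congr rfl fun i hi => by simp [flipOutside, h hi]

lemma sum_sgn_flipOutside_sdiff (A B : Finset (Fin N)) (ε : Fin N → Bool) :
    ∑ i ∈ B \ A, sgn (flipOutside A ε i) = -∑ i ∈ B \ A, sgn (ε i) := by
  rw [← Finset.sum_neg_distrib]
  refine Finset.sum_congr rfl fun i hi => ?_
  simp [flipOutside, (Finset.mem_sdiff.1 hi).2, sgn_not]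

lemma partialSups_congr_le {x y : ℕ → ℝ} {n : ℕ} (h : ∀ j ≤ n, x j = y j) :
    partialSups x n = partialSups y n :=
  le_antisymm (partialSups_le _ _ _ fun j hj => (h j hj).le.trans (le_partialSups_of_le y hj))
    (partialSups_le _ _ _ fun j hj => (h j hj).ge.trans (le_partialSups_of_le x hj))

lemma partialSups_nonneg {x : ℕ → ℝ} (h : ∀ j, 0 ≤ x j) (n : ℕ) : 0 ≤ partialSups x n :=
  (h 0).trans (le_partialSups_of_le x (Nat.zero_le n))

/-- The submartingale property, by pairing: flipping the signs outside `A j` keeps the running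
maximum up to `j` and negates the new part b of the signed sum. With a the old part, a pair
contributes a nonnegative multiple of exp(ca) (exp(cb) + exp(−cb) − 2), which is nonnegative because
cosh ≥ 1. -/
lemma sum_mul_increment_nonneg {A : ℕ → Finset (Fin N)} (hA : Monotone A) (c : ℝ) (j : ℕ) :
    0 ≤ ∑ ε : Fin N → Bool, partialSups (fun l => Real.exp (c * ∑ i ∈ A l, sgn (ε i))) j *
      (Real.exp (c * ∑ i ∈ A (j + 1), sgn (ε i)) - Real.exp (c * ∑ i ∈ A j, sgn (ε i))) := by
  set F : (Fin N → Bool) → ℝ := fun ε =>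
    partialSups (fun l => Real.exp (c * ∑ i ∈ A l, sgn (ε i))) j *
      (Real.exp (c * ∑ i ∈ A (j + 1), sgn (ε i)) - Real.exp (c * ∑ i ∈ A j, sgn (ε i))) with hF
  have hsplit : ∀ ε : Fin N → Bool, ∑ i ∈ A (j + 1), sgn (ε i)
      = ∑ i ∈ A j, sgn (ε i) + ∑ i ∈ A (j + 1) \ A j, sgn (ε i) := fun ε => by
    rw [add_comm (∑ i ∈ A j, _), Finset.sum_sdiff (hA (Nat.le_succ j))]
  have hpair : ∀ ε, 0 ≤ F ε + F (flipOutside (A j) ε) := by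
    intro ε
    have h1 : partialSups (fun l => Real.exp (c * ∑ i ∈ A l, sgn (flipOutside (A j) ε i))) j
        = partialSups (fun l => Real.exp (c * ∑ i ∈ A l, sgn (ε i))) j :=
      partialSups_congr_le fun l hl => by rw [sum_sgn_flipOutside_of_subset (hA hl)]
    simp only [hF]
    rw [h1, ← mul_add, hsplit, hsplit, sum_sgn_flipOutside_of_subset le_rfl,
      sum_sgn_flipOutside_sdiff]
    refine mul_nonneg (partialSups_nonneg (fun _ => (Real.exp_pos _).le) _) ?_
    set a := ∑ i ∈ A j, sgn (ε i)
    set b := ∑ i ∈ A (j + 1) \ A j, sgn (ε i)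
    rw [mul_add, mul_add, Real.exp_add, Real.exp_add]
    have h2 : 0 ≤ Real.exp (c * b) + Real.exp (c * -b) - 2 := by
      have := Real.one_le_cosh (c * b)
      rw [Real.cosh_eq] at this
      rw [mul_neg]; linarith
    nlinarith [Real.exp_pos (c * a)]
  have h2 : ∑ ε, F (flipOutside (A j) ε) = ∑ ε, F ε := Equiv.sum_comp _ _
  have h3 := Finset.sum_nonneg fun ε (_ : ε ∈ Finset.univ) => hpair ε
  rw [Finset.sum_add_distrib, h2] at h3
  linarith

/-- The sum factorizes over indices into factors 2 cosh c (inside `A`) or 2 (outside); all are at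
most 2 exp(c²/2), so the bound does not depend on `A`. -/
lemma sum_exp_sum_sgn_le (A : Finset (Fin N)) (c : ℝ) :
    ∑ ε : Fin N → Bool, Real.exp (c * ∑ i ∈ A, sgn (ε i)) ≤ 2 ^ N * Real.exp (N * (c ^ 2 / 2)) := by
  have h1 : ∀ ε : Fin N → Bool, Real.exp (c * ∑ i ∈ A, sgn (ε i))
      = ∏ i, (if i ∈ A then Real.exp (c * sgn (ε i)) else 1) := fun ε => by
    rw [Finset.mul_sum, Real.exp_sum, Finset.prod_ite_mem, Finset.univ_inter]
  have h2 := Finset.prod_univ_sum (fun _ : Fin N => (Finset.univ : Finset Bool))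
    (fun i b => if i ∈ A then Real.exp (c * sgn b) else 1)
  rw [Fintype.piFinset_univ] at h2
  simp_rw [h1]
  rw [← h2, Real.exp_nat_mul, ← mul_pow]
  refine (Finset.prod_le_prod (g := fun _ => 2 * Real.exp (c ^ 2 / 2))
    (fun i _ => Finset.sum_nonneg fun b _ => ?_) fun i _ => ?_).trans (by simp)
  · split_ifs <;> positivity
  have hc := Real.cosh_le_exp_half_sq c
  have hone : 1 ≤ Real.exp (c ^ 2 / 2) := Real.one_le_exp (by positivity)
  rw [Real.cosh_eq] at hc
  by_cases hi : i ∈ A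
  · simp [hi, sgn]; linarith
  · simp only [hi, if_false, Finset.sum_const, Finset.card_univ, Fintype.card_bool, nsmul_eq_mul]
    push_cast; linarith

/-- A maximal inequality for partial sums of random signs along an increasing family of index
sets. -/
lemma sum_partialSups_exp_sq_le {A : ℕ → Finset (Fin N)} (hA : Monotone A) (c : ℝ) (K : ℕ) :
    ∑ ε : Fin N → Bool, (partialSups (fun l => Real.exp (c * ∑ i ∈ A l, sgn (ε i))) K) ^ 2
      ≤ 4 * (2 ^ N * Real.exp (N * ((2 * c) ^ 2 / 2))) := by
  set X : (Fin N → Bool) → ℕ → ℝ := fun ε l => Real.exp (c * ∑ i ∈ A l, sgn (ε i)) with hX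
  have h1 : ∀ ε, (partialSups (X ε) K) ^ 2 / 4 ≤ X ε K ^ 2
      - ∑ j ∈ Finset.range K, partialSups (X ε) j * (X ε (j + 1) - X ε j) := fun ε => by
    -- With M the running maximum and x the last value, x M ≤ M²/4 + x² absorbs half of M²/2. This
    -- is the source of the factor 4.
    have := partialSups_sq_le (X ε) K
    nlinarith [sq_nonneg (partialSups (X ε) K - 2 * X ε K)]
  have h2 := Finset.sum_le_sum fun ε (_ : ε ∈ Finset.univ) => h1 ε
  rw [Finset.sum_sub_distrib, Finset.sum_comm, ← Finset.sum_div] at h2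
  have h3 : 0 ≤ ∑ j ∈ Finset.range K, ∑ ε, partialSups (X ε) j * (X ε (j + 1) - X ε j) :=
    Finset.sum_nonneg fun j _ => sum_mul_increment_nonneg hA c j
  have h4 : ∑ ε, X ε K ^ 2 ≤ 2 ^ N * Real.exp (N * ((2 * c) ^ 2 / 2)) := by
    refine le_trans (le_of_eq ?_) (sum_exp_sum_sgn_le (A K) (2 * c))
    refine Finset.sum_congr rfl fun ε _ => ?_
    rw [hX, ← Real.exp_nat_mul]; congr 1; push_cast; ring
  linarith

lemma measurable_partialSups {α : Type*} [MeasurableSpace α] {f : ℕ → α → ℝ}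
    (hf : ∀ j, Measurable (f j)) (K : ℕ) : Measurable fun a => partialSups (fun j => f j a) K := by
  induction K with
  | zero => simpa using hf 0
  | succ n ih =>
    simp only [partialSups_add_one]
    exact ih.sup (hf (n + 1))

lemma abs_sum_sgn_mul_le (ε : Fin N → Bool) {a : Fin N → ℝ} (ha : ∀ i, |a i| ≤ 1) :
    |∑ i, sgn (ε i) * a i| ≤ N := by
  refine (Finset.abs_sum_le_sum_abs _ _).trans ?_
  refine (Finset.sum_le_card_nsmul _ _ 1 fun i _ => ?_).trans (by simp)
  rw [abs_mul, abs_sgn, one_mul]; exact ha i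

/-- A maximal inequality for random signs with weights in `[0, 1]` that increase with the index. -/
lemma sum_partialSups_exp_le {a : ℕ → Fin N → ℝ} (ha : Monotone a)
    (h01 : ∀ j i, a j i ∈ Set.Icc (0 : ℝ) 1) (c : ℝ) (K : ℕ) :
    ∑ ε : Fin N → Bool, partialSups (fun j => Real.exp (c * ∑ i, sgn (ε i) * a j i)) K
      ≤ 4 * (2 ^ N * Real.exp (N * (c ^ 2 / 2))) := by
  classical
  -- Layer cake: for t uniform on (0, 1], the indicator of t ≤ a has mean a. For fixed t the index
  -- sets {i | t ≤ a j i} grow with j, which is the nested case; Jensen moves the average over t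
  -- outside.
  set ν : Measure ℝ := volume.restrict (Set.Ioc 0 1) with hν
  have : IsProbabilityMeasure ν := ⟨by simp [hν]⟩
  set b : ℝ → ℕ → Fin N → ℝ := fun t j i => if t ≤ a j i then 1 else 0 with hb
  have hbm : ∀ j i, Measurable fun t => b t j i := fun j i =>
    Measurable.ite measurableSet_Iic measurable_const measurable_const
  have hb1 : ∀ t j i, |b t j i| ≤ 1 := fun t j i => by
    simp only [hb]; split_ifs <;> simp
  have hbi : ∀ j i, ∫ t, b t j i ∂ν = a j i := fun j i => by
    have h : (fun t => b t j i) = (Set.Iic (a j i)).indicator 1 := by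
      ext t; simp [hb, Set.indicator_apply]
    rw [h, integral_indicator_one measurableSet_Iic, measureReal_def, hν,
      Measure.restrict_apply measurableSet_Iic]
    have : Set.Iic (a j i) ∩ Set.Ioc 0 1 = Set.Ioc 0 (a j i) := by
      ext t; simp only [Set.mem_inter_iff, Set.mem_Iic, Set.mem_Ioc]
      have := (h01 j i).2
      constructor
      · rintro ⟨h1, h2, h3⟩; exact ⟨h2, h1⟩
      · rintro ⟨h1, h2⟩; exact ⟨h2, h1, h2.trans this⟩
    rw [this]; simp [(h01 j i).1]
  have hbint : ∀ j i, Integrable (fun t => b t j i) ν := fun j i =>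
    Integrable.of_bound (hbm j i).aestronglyMeasurable 1 (ae_of_all _ fun t => hb1 t j i)
  have hSm : ∀ (ε : Fin N → Bool) j, Measurable fun t => ∑ i, sgn (ε i) * b t j i := fun ε j =>
    Finset.measurable_sum _ fun i _ => (hbm j i).const_mul _
  set E : (Fin N → Bool) → ℝ → ℕ → ℝ := fun ε t j =>
    Real.exp (c * ∑ i, sgn (ε i) * b t j i) with hE
  have hEm : ∀ ε j, Measurable fun t => E ε t j := fun ε j => ((hSm ε j).const_mul c).exp
  have hEb : ∀ ε t j, E ε t j ≤ Real.exp (|c| * N) := fun ε t j => by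
    refine Real.exp_le_exp.2 ((le_abs_self _).trans ?_)
    rw [abs_mul]
    exact mul_le_mul_of_nonneg_left (abs_sum_sgn_mul_le ε (hb1 t j)) (abs_nonneg _)
  have hEint : ∀ ε j, Integrable (fun t => E ε t j) ν := fun ε j =>
    Integrable.of_bound (hEm ε j).aestronglyMeasurable (Real.exp (|c| * N))
      (ae_of_all _ fun t => by rw [Real.norm_of_nonneg (Real.exp_pos _).le]; exact hEb ε t j)
  have hPint : ∀ ε, Integrable (fun t => partialSups (E ε t) K) ν := fun ε =>
    Integrable.of_bound (measurable_partialSups (hEm ε) K).aestronglyMeasurable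
      (Real.exp (|c| * N)) (ae_of_all _ fun t => by
        rw [Real.norm_of_nonneg (partialSups_nonneg (fun _ => (Real.exp_pos _).le) _)]
        exact partialSups_le _ _ _ fun j _ => hEb ε t j)
  have hle : ∀ ε : Fin N → Bool,
      partialSups (fun j => Real.exp (c * ∑ i, sgn (ε i) * a j i)) K
        ≤ ∫ t, partialSups (E ε t) K ∂ν := fun ε => by
    refine partialSups_le _ _ _ fun j hj => ?_
    have hlin : ∫ t, c * ∑ i, sgn (ε i) * b t j i ∂ν = c * ∑ i, sgn (ε i) * a j i := by
      rw [integral_const_mul, integral_finsetSum _ fun i _ => (hbint j i).const_mul _]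
      simp_rw [integral_const_mul, hbi]
    have hJ := convexOn_exp.map_integral_le (μ := ν) (f := fun t => c * ∑ i, sgn (ε i) * b t j i)
      Real.continuous_exp.continuousOn isClosed_univ (ae_of_all _ fun _ => Set.mem_univ _)
      ((integrable_finsetSum _ fun i _ => (hbint j i).const_mul _).const_mul c) (hEint ε j)
    rw [hlin] at hJ
    exact hJ.trans (integral_mono (hEint ε j) (hPint ε) fun t => le_partialSups_of_le (E ε t) hj)
  refine (Finset.sum_le_sum fun ε _ => hle ε).trans ?_
  rw [← integral_finsetSum _ fun ε _ => hPint ε]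
  have hpt : ∀ t, ∑ ε, partialSups (E ε t) K ≤ 4 * (2 ^ N * Real.exp (N * (c ^ 2 / 2))) := by
    intro t
    have hA : Monotone fun j => Finset.univ.filter fun i : Fin N => t ≤ a j i := fun j l hjl i hi =>
      by simp only [Finset.mem_filter, Finset.mem_univ, true_and] at hi ⊢; exact hi.trans (ha hjl i)
    -- The maximal inequality controls squares, so it is used at c/2: exp(c x) = exp(c x / 2)².
    have h := sum_partialSups_exp_sq_le hA (c / 2) K
    rw [mul_div_cancel₀ c two_ne_zero] at h
    refine (Finset.sum_le_sum fun ε _ => partialSups_le _ _ _ fun j hj => ?_).trans h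
    have hx := le_partialSups_of_le (fun l => Real.exp (c / 2 *
      ∑ i ∈ Finset.univ.filter fun i : Fin N => t ≤ a l i, sgn (ε i))) hj
    refine le_trans (le_of_eq ?_) (pow_le_pow_left₀ (Real.exp_pos _).le hx 2)
    rw [← Real.exp_nat_mul]
    simp only [hE, hb]
    congr 1
    rw [Finset.sum_filter]
    push_cast
    simp only [mul_ite, mul_one, mul_zero]
    ring
  refine (integral_mono (integrable_finsetSum _ fun ε _ => hPint ε) (integrable_const _) hpt).trans
    ?_
  simp

end Rademacher

/-! ### Symmetrization and exponential moments -/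

section Symmetrization

variable {Ω : Type*} [MeasurableSpace Ω] {N : ℕ}

lemma integrable_partialSups_exp {α : Type*} [MeasurableSpace α] {μ : Measure α}
    [IsFiniteMeasure μ] {g : ℕ → α → ℝ} (hg : ∀ j, Measurable (g j)) {B : ℝ}
    (hB : ∀ j a, |g j a| ≤ B) (K : ℕ) :
    Integrable (fun a => partialSups (fun j => Real.exp (g j a)) K) μ :=
  Integrable.of_bound (measurable_partialSups (fun j => (hg j).exp) K).aestronglyMeasurable
    (Real.exp B) (ae_of_all _ fun a => by
      rw [Real.norm_of_nonneg (partialSups_nonneg (fun _ => (Real.exp_pos _).le) _)]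
      exact partialSups_le _ _ _ fun j _ => Real.exp_le_exp.2 ((le_abs_self _).trans (hB j a)))

lemma abs_sum_le_of_abs_le {x : Fin N → ℝ} {b : ℝ} (h : ∀ i, |x i| ≤ b) : |∑ i, x i| ≤ N * b := by
  refine (Finset.abs_sum_le_sum_abs _ _).trans ?_
  refine (Finset.sum_le_card_nsmul _ _ b fun i _ => h i).trans (by simp)

lemma abs_const_mul_sum_le {x : Fin N → ℝ} {b : ℝ} (h : ∀ i, |x i| ≤ b) (c : ℝ) :
    |c * ∑ i, x i| ≤ |c| * (N * b) := by
  rw [abs_mul]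
  exact mul_le_mul_of_nonneg_left (abs_sum_le_of_abs_le h) (abs_nonneg c)

/-- Exchanging the two entries of the pairs not selected by `ε`. -/
def swapBy {α : Type*} (ε : Fin N → Bool) (z : Fin N → α × α) (i : Fin N) : α × α :=
  if ε i then z i else (z i).swap

lemma sub_swapBy {α : Type*} (g : α → ℝ) (ε : Fin N → Bool) (z : Fin N → α × α) (i : Fin N) :
    g (swapBy ε z i).1 - g (swapBy ε z i).2 = sgn (ε i) * (g (z i).1 - g (z i).2) := by
  cases h : ε i <;> simp [swapBy, sgn, h]

variable {Q : Measure Ω} [IsProbabilityMeasure Q] {f : ℕ → Ω → ℝ}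

lemma abs_sub_le_one_of_mem_Icc {x y : ℝ} (hx : x ∈ Set.Icc (0 : ℝ) 1)
    (hy : y ∈ Set.Icc (0 : ℝ) 1) : |x - y| ≤ 1 :=
  abs_sub_le_iff.2 ⟨by linarith [hx.2, hy.1], by linarith [hx.1, hy.2]⟩

lemma integrable_of_mem_Icc_zero_one {g : Ω → ℝ} (hg : Measurable g)
    (h01 : ∀ o, g o ∈ Set.Icc (0 : ℝ) 1) : Integrable g Q :=
  Integrable.of_bound hg.aestronglyMeasurable 1 (ae_of_all _ fun o => by
    rw [Real.norm_of_nonneg (h01 o).1]; exact (h01 o).2)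

lemma integral_mem_Icc_zero_one {g : Ω → ℝ} (hg : Measurable g)
    (h01 : ∀ o, g o ∈ Set.Icc (0 : ℝ) 1) : ∫ o, g o ∂Q ∈ Set.Icc (0 : ℝ) 1 := by
  refine ⟨integral_nonneg fun o => (h01 o).1, ?_⟩
  refine (integral_mono (integrable_of_mem_Icc_zero_one hg h01) (integrable_const 1)
    fun o => (h01 o).2).trans (by simp)

/-- Replacing the mean by an independent copy of the sample. -/
lemma integral_partialSups_exp_le_ghost (hf : ∀ j, Measurable (f j))
    (h01 : ∀ j o, f j o ∈ Set.Icc (0 : ℝ) 1) (c : ℝ) (K : ℕ) :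
    ∫ s, partialSups (fun j => Real.exp (c * ∑ i, (f j (s i) - ∫ o, f j o ∂Q))) K
        ∂(Measure.pi fun _ : Fin N => Q)
      ≤ ∫ z, partialSups (fun j => Real.exp (c * ∑ i, (f j (z i).1 - f j (z i).2))) K
        ∂(Measure.pi fun _ : Fin N => Q.prod Q) := by
  set P : Measure (Fin N → Ω) := Measure.pi fun _ : Fin N => Q
  have hmp := measurePreserving_arrowProdEquivProdArrow Ω Ω (Fin N) (fun _ => Q) (fun _ => Q)
  set Φ : (Fin N → Ω) × (Fin N → Ω) → ℝ := fun w =>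
    partialSups (fun j => Real.exp (c * ∑ i, (f j (w.1 i) - f j (w.2 i)))) K with hΦ
  have hexpm : ∀ j, Measurable fun w : (Fin N → Ω) × (Fin N → Ω) =>
      c * ∑ i, (f j (w.1 i) - f j (w.2 i)) := fun j =>
    (Finset.measurable_sum _ fun i _ =>
      ((hf j).comp ((measurable_pi_apply i).comp measurable_fst)).sub
        ((hf j).comp ((measurable_pi_apply i).comp measurable_snd))).const_mul c
  have hexpb : ∀ j (w : (Fin N → Ω) × (Fin N → Ω)),
      |c * ∑ i, (f j (w.1 i) - f j (w.2 i))| ≤ |c| * (N * 1) := fun j w =>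
    abs_const_mul_sum_le (fun i => abs_sub_le_one_of_mem_Icc (h01 j _) (h01 j _)) c
  have hΦint : Integrable Φ (P.prod P) := integrable_partialSups_exp hexpm hexpb K
  have h1 : ∫ z, partialSups (fun j => Real.exp (c * ∑ i, (f j (z i).1 - f j (z i).2))) K
        ∂(Measure.pi fun _ : Fin N => Q.prod Q) = ∫ w, Φ w ∂(P.prod P) :=
    hmp.integral_comp' Φ
  rw [h1, integral_prod _ hΦint]
  refine integral_mono (integrable_partialSups_exp (B := |c| * (N * 1)) (fun j => ?_)
    (fun j s => ?_) K) hΦint.integral_prod_left fun s => ?_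
  · exact (Finset.measurable_sum _ fun i _ =>
      ((hf j).comp (measurable_pi_apply i)).sub_const _).const_mul c
  · exact abs_const_mul_sum_le (fun i => abs_sub_le_one_of_mem_Icc (h01 j _)
      (integral_mem_Icc_zero_one (hf j) (h01 j))) c
  refine partialSups_le _ _ _ fun j hj => ?_
  have hgm : Measurable fun s' : Fin N → Ω => c * ∑ i, (f j (s i) - f j (s' i)) :=
    (hexpm j).comp measurable_prodMk_left
  have hgb : ∀ s' : Fin N → Ω, |c * ∑ i, (f j (s i) - f j (s' i))| ≤ |c| * (N * 1) :=
    fun s' => hexpb j (s, s')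
  have hgint : Integrable (fun s' : Fin N → Ω => c * ∑ i, (f j (s i) - f j (s' i))) P :=
    Integrable.of_bound hgm.aestronglyMeasurable _ (ae_of_all _ hgb)
  have hgexp : Integrable (fun s' : Fin N → Ω => Real.exp (c * ∑ i, (f j (s i) - f j (s' i)))) P :=
    Integrable.of_bound hgm.exp.aestronglyMeasurable (Real.exp (|c| * (N * 1)))
      (ae_of_all _ fun s' => by
        rw [Real.norm_of_nonneg (Real.exp_pos _).le]
        exact Real.exp_le_exp.2 ((le_abs_self _).trans (hgb s')))
  have hcoord : ∀ i : Fin N, ∫ s' : Fin N → Ω, f j (s' i) ∂P = ∫ o, f j o ∂Q := fun i => by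
    have hev := measurePreserving_eval (fun _ : Fin N => Q) i
    rw [← hev.map_eq, integral_map hev.measurable.aemeasurable (hf j).aestronglyMeasurable]
  have hcoordint : ∀ i : Fin N, Integrable (fun s' : Fin N → Ω => f j (s' i)) P := fun i =>
    integrable_of_mem_Icc_zero_one ((hf j).comp (measurable_pi_apply i)) fun s' => h01 j _
  have hmean : ∫ s' : Fin N → Ω, c * ∑ i, (f j (s i) - f j (s' i)) ∂P
      = c * ∑ i, (f j (s i) - ∫ o, f j o ∂Q) := by
    have hint : ∀ i : Fin N, Integrable (fun s' : Fin N → Ω => f j (s i) - f j (s' i)) P := fun i =>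
      (integrable_const _).sub (hcoordint i)
    rw [integral_const_mul, integral_finsetSum _ fun i _ => hint i]
    congr 1
    refine Finset.sum_congr rfl fun i _ => ?_
    rw [integral_sub (integrable_const _) (hcoordint i), hcoord]
    simp
  -- Jensen in the ghost sample alone, with `s` frozen: the centred sum is the ghost average of the
  -- differences.
  have hJ := convexOn_exp.map_integral_le (μ := P)
    (f := fun s' : Fin N → Ω => c * ∑ i, (f j (s i) - f j (s' i)))
    Real.continuous_exp.continuousOn isClosed_univ (ae_of_all _ fun _ => Set.mem_univ _)
    hgint hgexp
  rw [hmean] at hJ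
  refine hJ.trans (integral_mono hgexp
    (integrable_partialSups_exp (fun j => (hexpm j).comp measurable_prodMk_left)
      (fun j s' => hexpb j (s, s')) K) fun s' => ?_)
  exact le_partialSups_of_le (fun j => Real.exp (c * ∑ i, (f j (s i) - f j (s' i)))) hj

lemma measurePreserving_swapBy (ε : Fin N → Bool) :
    MeasurePreserving (swapBy ε) (Measure.pi fun _ : Fin N => Q.prod Q)
      (Measure.pi fun _ : Fin N => Q.prod Q) := by
  refine measurePreserving_pi (f := fun i (p : Ω × Ω) => if ε i then p else p.swap)
    (fun _ : Fin N => Q.prod Q) (fun _ : Fin N => Q.prod Q) fun i => ?_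
  cases ε i
  · simpa using Measure.measurePreserving_swap
  · simpa using! MeasurePreserving.id (Q.prod Q)

/-- The exponential moments of the largest deviation of an increasing family of functions with
values in `[0, 1]`. -/
lemma integral_partialSups_exp_le (hf : ∀ j, Measurable (f j)) (hmono : Monotone f)
    (h01 : ∀ j o, f j o ∈ Set.Icc (0 : ℝ) 1) (c : ℝ) (K : ℕ) :
    ∫ s, partialSups (fun j => Real.exp (c * ∑ i, (f j (s i) - ∫ o, f j o ∂Q))) K
        ∂(Measure.pi fun _ : Fin N => Q) ≤ 4 * Real.exp (N * (2 * c ^ 2)) := by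
  refine (integral_partialSups_exp_le_ghost hf h01 c K).trans ?_
  set P2 : Measure (Fin N → Ω × Ω) := Measure.pi fun _ : Fin N => Q.prod Q
  set Ψ : (Fin N → Ω × Ω) → ℝ := fun z =>
    partialSups (fun j => Real.exp (c * ∑ i, (f j (z i).1 - f j (z i).2))) K with hΨ
  have hΨint : Integrable Ψ P2 :=
    integrable_partialSups_exp (fun j => (Finset.measurable_sum _ fun i _ =>
      ((hf j).comp (measurable_fst.comp (measurable_pi_apply i))).sub
        ((hf j).comp (measurable_snd.comp (measurable_pi_apply i)))).const_mul c)
      (fun j z => abs_const_mul_sum_le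
        (fun i => abs_sub_le_one_of_mem_Icc (h01 j _) (h01 j _)) c) K
  have hmp : ∀ ε : Fin N → Bool, MeasurePreserving (swapBy ε) P2 P2 := measurePreserving_swapBy
  have hswap : ∀ ε : Fin N → Bool, ∫ z, Ψ (swapBy ε z) ∂P2 = ∫ z, Ψ z ∂P2 := fun ε => by
    have h := integral_map (hmp ε).measurable.aemeasurable
      (((hmp ε).map_eq).symm ▸ hΨint.aestronglyMeasurable)
    rw [(hmp ε).map_eq] at h
    exact h.symm
  have hsint : ∀ ε : Fin N → Bool, Integrable (fun z => Ψ (swapBy ε z)) P2 := fun ε =>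
    (hmp ε).integrable_comp_of_integrable hΨint
  -- Every swap pattern preserves the law of the pairs, so the integral may be averaged over all
  -- patterns, which brings in the random signs.
  have hsum : 2 ^ N * ∫ z, Ψ z ∂P2 = ∫ z, ∑ ε : Fin N → Bool, Ψ (swapBy ε z) ∂P2 := by
    rw [integral_finsetSum _ fun ε _ => hsint ε]
    simp [hswap]
  have hpt : ∀ z, ∑ ε : Fin N → Bool, Ψ (swapBy ε z)
      ≤ 2 ^ N * (4 * Real.exp (N * (2 * c ^ 2))) := by
    intro z
    -- The differences f(z.1) − f(z.2) are not monotone in `j`, but each half is. The inequality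
    -- exp(x − y) ≤ (exp(2x) + exp(−2y))/2 separates the halves at the price of doubling `c`.
    have ha := sum_partialSups_exp_le (a := fun j i => f j (z i).1)
      (fun j l h i => hmono h _) (fun j i => h01 j _) (2 * c) K
    have hb := sum_partialSups_exp_le (a := fun j i => f j (z i).2)
      (fun j l h i => hmono h _) (fun j i => h01 j _) (-(2 * c)) K
    have hle : ∀ ε : Fin N → Bool, Ψ (swapBy ε z)
        ≤ (partialSups (fun j => Real.exp (2 * c * ∑ i, sgn (ε i) * f j (z i).1)) K
          + partialSups (fun j => Real.exp (-(2 * c) * ∑ i, sgn (ε i) * f j (z i).2)) K) / 2 := by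
      intro ε
      refine partialSups_le _ _ _ fun j hj => ?_
      have h1 := le_partialSups_of_le
        (fun j => Real.exp (2 * c * ∑ i, sgn (ε i) * f j (z i).1)) hj
      have h2 := le_partialSups_of_le
        (fun j => Real.exp (-(2 * c) * ∑ i, sgn (ε i) * f j (z i).2)) hj
      refine le_trans ?_ (div_le_div_of_nonneg_right (add_le_add h1 h2) zero_le_two)
      simp only [sub_swapBy, mul_sub, Finset.sum_sub_distrib]
      set x := ∑ i, sgn (ε i) * f j (z i).1
      set y := ∑ i, sgn (ε i) * f j (z i).2
      have e1 : Real.exp (2 * c * x) = Real.exp (c * x) ^ 2 := by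
        rw [← Real.exp_nat_mul]; congr 1; push_cast; ring
      have e2 : Real.exp (-(2 * c) * y) = Real.exp (-(c * y)) ^ 2 := by
        rw [← Real.exp_nat_mul]; congr 1; push_cast; ring
      rw [e1, e2, sub_eq_add_neg, Real.exp_add]
      nlinarith [sq_nonneg (Real.exp (c * x) - Real.exp (-(c * y)))]
    refine (Finset.sum_le_sum fun ε _ => hle ε).trans ?_
    rw [← Finset.sum_div, Finset.sum_add_distrib]
    have e : (-(2 * c)) ^ 2 / 2 = 2 * c ^ 2 := by ring
    have e' : (2 * c) ^ 2 / 2 = 2 * c ^ 2 := by ring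
    rw [e] at hb
    rw [e'] at ha
    linarith
  have hfin : ∫ z, ∑ ε : Fin N → Bool, Ψ (swapBy ε z) ∂P2
      ≤ 2 ^ N * (4 * Real.exp (N * (2 * c ^ 2))) :=
    (integral_mono (integrable_finsetSum _ fun ε _ => hsint ε) (integrable_const _) hpt).trans
      (by simp)
  rw [← hsum] at hfin
  exact le_of_mul_le_mul_left hfin (by positivity)

/-- Chernoff's method, with Markov's inequality applied to the running maximum of the exponentials.
-/
lemma pi_exists_le_deviation_le (hf : ∀ j, Measurable (f j)) (hmono : Monotone f)
    (h01 : ∀ j o, f j o ∈ Set.Icc (0 : ℝ) 1) {c : ℝ} (K : ℕ) (v : ℝ) :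
    (Measure.pi fun _ : Fin N => Q)
        {s | ∃ j ≤ K, v ≤ c * ∑ i, (f j (s i) - ∫ o, f j o ∂Q)}
      ≤ ENNReal.ofReal (4 * Real.exp (N * (2 * c ^ 2) - v)) := by
  set P : Measure (Fin N → Ω) := Measure.pi fun _ : Fin N => Q
  set g : (Fin N → Ω) → ℝ := fun s =>
    partialSups (fun j => Real.exp (c * ∑ i, (f j (s i) - ∫ o, f j o ∂Q))) K with hg
  have hint : Integrable g P := integrable_partialSups_exp (B := |c| * (N * 1))
    (fun j => (Finset.measurable_sum _ fun i _ =>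
      ((hf j).comp (measurable_pi_apply i)).sub_const _).const_mul c)
    (fun j s => abs_const_mul_sum_le (fun i => abs_sub_le_one_of_mem_Icc (h01 j _)
      (integral_mem_Icc_zero_one (hf j) (h01 j))) c) K
  have hsub : {s | ∃ j ≤ K, v ≤ c * ∑ i, (f j (s i) - ∫ o, f j o ∂Q)} ⊆ {s | Real.exp v ≤ g s} := by
    rintro s ⟨j, hj, h⟩
    exact (Real.exp_le_exp.2 h).trans (le_partialSups_of_le
      (fun j => Real.exp (c * ∑ i, (f j (s i) - ∫ o, f j o ∂Q))) hj)
  have hM := mul_meas_ge_le_integral_of_nonneg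
    (ae_of_all P fun s => partialSups_nonneg (fun _ => (Real.exp_pos _).le) K) hint (Real.exp v)
  have hI := integral_partialSups_exp_le (Q := Q) (N := N) hf hmono h01 c K
  refine (measure_mono hsub).trans ?_
  rw [← ofReal_measureReal]
  refine ENNReal.ofReal_le_ofReal ?_
  rw [Real.exp_sub, ← mul_div_assoc, le_div_iff₀ (Real.exp_pos v), mul_comm]
  exact hM.trans hI

lemma pi_exists_le_abs_deviation_le (hf : ∀ j, Measurable (f j)) (hmono : Monotone f)
    (h01 : ∀ j o, f j o ∈ Set.Icc (0 : ℝ) 1) (K : ℕ) {u : ℝ} (hu : 0 < u) :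
    (Measure.pi fun _ : Fin N => Q)
        {s | ∃ j ≤ K, N * u ≤ |∑ i, (f j (s i) - ∫ o, f j o ∂Q)|}
      ≤ ENNReal.ofReal (8 * Real.exp (-(N * u ^ 2 / 8))) := by
  -- The choice c = u/4 minimizes 2c² − cu, with value −u²/8; the lower tail uses −c.
  have h1 := pi_exists_le_deviation_le (N := N) (Q := Q) hf hmono h01 (c := u / 4) K
    (u / 4 * (N * u))
  have h2 := pi_exists_le_deviation_le (N := N) (Q := Q) hf hmono h01 (c := -(u / 4)) K
    (u / 4 * (N * u))
  have e1 : N * (2 * (u / 4) ^ 2) - u / 4 * (N * u) = -(N * u ^ 2 / 8) := by ring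
  have e2 : N * (2 * (-(u / 4)) ^ 2) - u / 4 * (N * u) = -(N * u ^ 2 / 8) := by ring
  rw [e1] at h1
  rw [e2] at h2
  have hsplit : (8 : ℝ) * Real.exp (-(N * u ^ 2 / 8))
      = 4 * Real.exp (-(N * u ^ 2 / 8)) + 4 * Real.exp (-(N * u ^ 2 / 8)) := by ring
  rw [hsplit, ENNReal.ofReal_add (by positivity) (by positivity)]
  refine (measure_mono ?_).trans ((measure_union_le _ _).trans (add_le_add h1 h2))
  rintro s ⟨j, hj, h⟩
  rcases le_abs.1 h with h | h
  · exact Or.inl ⟨j, hj, mul_le_mul_of_nonneg_left h (by positivity)⟩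
  · refine Or.inr ⟨j, hj, ?_⟩
    rw [neg_mul, ← mul_neg]
    exact mul_le_mul_of_nonneg_left h (by positivity)

end Symmetrization

/-! ### Uniform deviations over a real index -/

section UniformDeviation

variable {Ω : Type*} [MeasurableSpace Ω] {N : ℕ} {Q : Measure Ω} [IsProbabilityMeasure Q]
  {f : ℝ → Ω → ℝ}

/-- Listing `J` in increasing order, and repeating its last element forever, turns it into a
monotone sequence. -/
lemma pi_exists_mem_finset_le (hf : ∀ η, Measurable (f η)) (hmono : Monotone f)
    (h01 : ∀ η o, f η o ∈ Set.Icc (0 : ℝ) 1) {u : ℝ} (hu : 0 < u) {J : Finset ℝ}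
    (hJ : J.Nonempty) :
    (Measure.pi fun _ : Fin N => Q)
        {s | ∃ η ∈ J, N * u ≤ |∑ i, (f η (s i) - ∫ o, f η o ∂Q)|}
      ≤ ENNReal.ofReal (8 * Real.exp (-(N * u ^ 2 / 8))) := by
  have hpos : 0 < J.card := hJ.card_pos
  set e : ℕ → ℝ := fun j => J.orderEmbOfFin rfl ⟨min j (J.card - 1), by omega⟩ with he
  have hemono : Monotone e := fun j l hjl => by
    refine (J.orderEmbOfFin rfl).monotone ?_
    exact Fin.mk_le_mk.2 (min_le_min_right _ hjl)
  refine (measure_mono ?_).trans (pi_exists_le_abs_deviation_le (fun j => hf (e j))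
    (hmono.comp hemono) (fun j => h01 (e j)) (J.card - 1) hu)
  rintro s ⟨η, hη, h⟩
  have hr : η ∈ Set.range (J.orderEmbOfFin rfl) := by
    rw [Finset.range_orderEmbOfFin]; exact hη
  obtain ⟨i, rfl⟩ := hr
  have hi : e i = J.orderEmbOfFin rfl i := by
    simp only [he]
    congr 1
    exact Fin.ext (min_eq_left (by omega))
  exact ⟨i, by omega, by rw [hi]; exact h⟩

/-- The bound for finite sets does not depend on their size, so it survives an increasing union. -/
lemma pi_exists_mem_countable_le (hf : ∀ η, Measurable (f η)) (hmono : Monotone f)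
    (h01 : ∀ η o, f η o ∈ Set.Icc (0 : ℝ) 1) {u : ℝ} (hu : 0 < u) {S : Set ℝ}
    (hS : S.Countable) (hne : S.Nonempty) :
    (Measure.pi fun _ : Fin N => Q)
        {s | ∃ η ∈ S, N * u ≤ |∑ i, (f η (s i) - ∫ o, f η o ∂Q)|}
      ≤ ENNReal.ofReal (8 * Real.exp (-(N * u ^ 2 / 8))) := by
  obtain ⟨e, rfl⟩ := hS.exists_eq_range hne
  set E : ℕ → Set (Fin N → Ω) := fun n =>
    {s | ∃ η ∈ (Finset.range (n + 1)).image e, N * u ≤ |∑ i, (f η (s i) - ∫ o, f η o ∂Q)|} with hE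
  have hEm : Monotone E := by
    rintro n m hnm s ⟨η, hη, h⟩
    exact ⟨η, Finset.image_subset_image (Finset.range_mono (by omega)) hη, h⟩
  refine (measure_mono (t := ⋃ n, E n) ?_).trans ?_
  · rintro s ⟨_, ⟨n, rfl⟩, h⟩
    exact Set.mem_iUnion.2 ⟨n, e n, Finset.mem_image_of_mem e (Finset.self_mem_range_succ n), h⟩
  · rw [hEm.measure_iUnion]
    exact iSup_le fun n => pi_exists_mem_finset_le hf hmono h01 hu (by simp)

/-- A uniform deviation inequality for an increasing family of functions with values in `[0, 1]`,
without measurability in the index. -/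
theorem pi_exists_abs_deviation_le (hf : ∀ η, Measurable (f η)) (hmono : Monotone f)
    (h01 : ∀ η o, f η o ∈ Set.Icc (0 : ℝ) 1) {u : ℝ} (hu : 0 < u) :
    (Measure.pi fun _ : Fin N => Q)
        {s | ∃ η, N * u < |∑ i, (f η (s i) - ∫ o, f η o ∂Q)|}
      ≤ ENNReal.ofReal (8 * Real.exp (-(N * u ^ 2 / 32))) := by
  set M : ℝ → ℝ := fun η => ∫ o, f η o ∂Q with hM
  have hMm : Monotone M := fun a b hab => integral_mono
    (integrable_of_mem_Icc_zero_one (hf a) (h01 a))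
    (integrable_of_mem_Icc_zero_one (hf b) (h01 b)) (hmono hab)
  -- A monotone mean has countably many discontinuities, which join the index set. At a continuity
  -- point, the sample sum is bracketed by those at nearby rationals, whose means differ by less
  -- than u/2. Hence a deviation u at η forces a deviation u/2 on `S`.
  set S : Set ℝ := Set.range ((↑) : ℚ → ℝ) ∪ {η | ¬ ContinuousAt M η} with hS
  have hSc : S.Countable := (Set.countable_range _).union hMm.countable_not_continuousAt
  have hSn : S.Nonempty := ⟨((0 : ℚ) : ℝ), Or.inl ⟨0, rfl⟩⟩
  have h := pi_exists_mem_countable_le (N := N) (Q := Q) hf hmono h01 (half_pos hu) hSc hSn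
  have e : (N : ℝ) * (u / 2) ^ 2 / 8 = N * u ^ 2 / 32 := by ring
  rw [e] at h
  refine (measure_mono ?_).trans h
  rintro s ⟨η, hη⟩
  have hN : (0 : ℝ) ≤ N := Nat.cast_nonneg N
  by_cases hc : ContinuousAt M η
  swap
  · refine ⟨η, Or.inr hc, le_trans ?_ hη.le⟩
    nlinarith
  have hnear : ∀ᶠ x in 𝓝 η, |M x - M η| < u / 2 := by
    have := hc.eventually (Metric.ball_mem_nhds (M η) (half_pos hu))
    filter_upwards [this] with x hx
    simpa [Real.dist_eq] using hx
  obtain ⟨a, b, ⟨ha, hb⟩, hab⟩ := (mem_nhds_iff_exists_Ioo_subset.1 hnear)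
  obtain ⟨q, hq1, hq2⟩ := exists_rat_btwn ha
  obtain ⟨r, hr1, hr2⟩ := exists_rat_btwn hb
  have hMq : |M q - M η| < u / 2 := hab ⟨hq1, hq2.trans hb⟩
  have hMr : |M r - M η| < u / 2 := hab ⟨ha.trans hr1, hr2⟩
  have hsum : ∀ x : ℝ, ∑ i, (f x (s i) - M x) = ∑ i, f x (s i) - N * M x := fun x => by
    simp [Finset.sum_sub_distrib]
  have hfq : ∑ i, f q (s i) ≤ ∑ i, f η (s i) := Finset.sum_le_sum fun i _ => hmono hq2.le _
  have hfr : ∑ i, f η (s i) ≤ ∑ i, f r (s i) := Finset.sum_le_sum fun i _ => hmono hr1.le _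
  change N * u < |∑ i, (f η (s i) - M η)| at hη
  rw [hsum] at hη
  rcases lt_abs.1 hη with h1 | h1
  · refine ⟨r, Or.inl ⟨r, rfl⟩, le_trans ?_ (le_abs_self _)⟩
    change _ ≤ ∑ i, (f r (s i) - M r)
    rw [hsum]
    nlinarith [(abs_lt.1 hMr).2]
  · refine ⟨q, Or.inl ⟨q, rfl⟩, le_trans ?_ (neg_le_abs _)⟩
    change _ ≤ -∑ i, (f q (s i) - M q)
    rw [hsum]
    nlinarith [(abs_lt.1 hMq).1]

end UniformDeviation

/-! ### Signed combinations of monotone families -/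

section LinearCombination

variable {Ω : Type*} [MeasurableSpace Ω] {N : ℕ} {Q : Measure Ω} [IsProbabilityMeasure Q]

/-- A uniform deviation inequality for signed combinations of increasing families with values in
`[0, 1]`. -/
lemma pi_exists_abs_deviation_combination_le {ι : Type*} [Fintype ι] {f : ι → ℝ → Ω → ℝ}
    (hf : ∀ r η, Measurable (f r η)) (hmono : ∀ r, Monotone (f r))
    (h01 : ∀ r η o, f r η o ∈ Set.Icc (0 : ℝ) 1) {σ : ι → ℝ} (hσ : ∀ r, |σ r| ≤ 1) {B b : ℝ}
    (hB : 0 ≤ B) {ψ : ℝ → Ω → ℝ} (hψ : ∀ η o, ψ η o = b + B * ∑ r, σ r * f r η o) {u : ℝ}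
    (hu : 0 < u) :
    (Measure.pi fun _ : Fin N => Q)
        {s | ∃ η, B * (Fintype.card ι * (N * u)) < |∑ i, (ψ η (s i) - ∫ o, ψ η o ∂Q)|}
      ≤ Fintype.card ι * ENNReal.ofReal (8 * Real.exp (-(N * u ^ 2 / 32))) := by
  refine (measure_mono (t := ⋃ r, {s | ∃ η, N * u < |∑ i, (f r η (s i) - ∫ o, f r η o ∂Q)|})
    ?_).trans ((measure_iUnion_fintype_le _ _).trans ?_)
  swap
  · refine (Finset.sum_le_sum fun r _ =>
      pi_exists_abs_deviation_le (N := N) (Q := Q) (hf r) (hmono r) (h01 r) hu).trans ?_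
    simp
  rintro s ⟨η, hη⟩
  by_contra hcon
  simp only [Set.mem_iUnion, Set.mem_ofPred_eq, not_exists, not_lt] at hcon
  have hint : ∀ r, Integrable (fun o => σ r * f r η o) Q := fun r =>
    (integrable_of_mem_Icc_zero_one (hf r η) (h01 r η)).const_mul _
  have hI : ∫ o, ψ η o ∂Q = b + B * ∑ r, σ r * ∫ o, f r η o ∂Q := by
    simp_rw [hψ]
    rw [integral_add (integrable_const _) ((integrable_finsetSum _ fun r _ => hint r).const_mul _),
      integral_const_mul, integral_finsetSum _ fun r _ => hint r]
    simp [integral_const_mul]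
  have hdev : ∑ i, (ψ η (s i) - ∫ o, ψ η o ∂Q)
      = B * ∑ r, σ r * ∑ i, (f r η (s i) - ∫ o, f r η o ∂Q) := by
    rw [hI]
    simp_rw [hψ, Finset.mul_sum]
    rw [Finset.sum_comm (s := Finset.univ (α := ι))]
    refine Finset.sum_congr rfl fun i _ => ?_
    rw [add_sub_add_left_eq_sub, ← Finset.sum_sub_distrib]
    exact Finset.sum_congr rfl fun r _ => by ring
  rw [hdev, abs_mul, abs_of_nonneg hB] at hη
  refine absurd hη (not_lt.2 (mul_le_mul_of_nonneg_left ?_ hB))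
  refine (Finset.abs_sum_le_sum_abs _ _).trans ?_
  refine (Finset.sum_le_card_nsmul _ _ (N * u) fun r _ => ?_).trans (by simp)
  rw [abs_mul]
  exact (mul_le_of_le_one_left (abs_nonneg _) (hσ r)).trans (hcon r η)

end LinearCombination

/-! ### Measurability of the score and of the moment -/

section Measurability

variable {k : ℕ}

lemma measurable_D : Measurable (D (k := k)) := measurable_snd.comp measurable_XD

lemma measurable_R : Measurable (R (k := k)) :=
  measurable_snd.comp (measurable_snd.comp (measurable_snd.comp measurable_snd))

lemma measurable_Y1 : Measurable (Y1 (k := k)) := measurable_fst.comp measurable_snd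

lemma measurable_Y0 : Measurable (Y0 (k := k)) :=
  measurable_fst.comp (measurable_snd.comp measurable_snd)

lemma measurable_bool_rec {α : Type*} [MeasurableSpace α] {g : Bool → α → ℝ} {d : α → Bool}
    (hg : ∀ b, Measurable (g b)) (hd : Measurable d) : Measurable fun a => g (d a) a := by
  have h : (fun a => g (d a) a) = fun a => if d a = true then g true a else g false a := by
    ext a; cases d a <;> simp
  rw [h]
  exact Measurable.ite (hd (measurableSet_singleton true)) (hg true) (hg false)

lemma measurable_Yobs : Measurable (Yobs (k := k)) :=
  Measurable.ite (measurable_D (measurableSet_singleton true)) measurable_Y1 measurable_Y0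

lemma measurable_potential : Measurable (potential (k := k)) :=
  measurable_Y1.prodMk measurable_Y0

variable {𝒯 : Type*} [MeasurableSpace 𝒯] {L : 𝒯 → Fit k}

namespace MeasurableFit

/-- Freezes the training data: results about a single fit are stated for a rule indexed by `Unit`.
-/
lemma fixed (hL : MeasurableFit L) (t : 𝒯) : MeasurableFit fun _ : Unit => L t where
  lower d := (hL.lower d).comp (measurable_const.prodMk measurable_snd : Measurable
    fun p : Unit × Cov k => (t, p.2))
  upper d := (hL.upper d).comp (measurable_const.prodMk measurable_snd : Measurable
    fun p : Unit × Cov k => (t, p.2))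
  hL := hL.hL.comp (measurable_const.prodMk measurable_snd : Measurable
    fun p : Unit × Cov k => (t, p.2))
  hR := hL.hR.comp (measurable_const.prodMk measurable_snd : Measurable
    fun p : Unit × Cov k => (t, p.2))
  mHat d := (hL.mHat d).comp (measurable_const.prodMk measurable_snd : Measurable
    fun p : Unit × ℝ × Cov k => (t, p.2))
  piHat d := (hL.piHat d).comp (measurable_const.prodMk measurable_snd : Measurable
    fun p : Unit × Cov k => (t, p.2))

lemma measurable_cL (hL : MeasurableFit L) : Measurable fun p : 𝒯 × Obs k => (L p.1).cL p.2 := by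
  have hX : Measurable fun p : 𝒯 × Obs k => (p.1, X p.2) :=
    measurable_fst.prodMk (measurable_X.comp measurable_snd)
  exact Measurable.ite ((measurable_D.comp measurable_snd) (measurableSet_singleton true))
    ((measurable_Yobs.comp measurable_snd).sub ((hL.upper false).comp hX))
    (((hL.lower true).comp hX).sub (measurable_Yobs.comp measurable_snd))

lemma measurable_cR (hL : MeasurableFit L) : Measurable fun p : 𝒯 × Obs k => (L p.1).cR p.2 := by
  have hX : Measurable fun p : 𝒯 × Obs k => (p.1, X p.2) :=
    measurable_fst.prodMk (measurable_X.comp measurable_snd)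
  exact Measurable.ite ((measurable_D.comp measurable_snd) (measurableSet_singleton true))
    ((measurable_Yobs.comp measurable_snd).sub ((hL.lower false).comp hX))
    (((hL.upper true).comp hX).sub (measurable_Yobs.comp measurable_snd))

lemma measurable_score (hL : MeasurableFit L) :
    Measurable fun p : 𝒯 × Obs k => (L p.1).score p.2 := by
  have hX : Measurable fun p : 𝒯 × Obs k => (p.1, X p.2) :=
    measurable_fst.prodMk (measurable_X.comp measurable_snd)
  exact ((hL.hL.comp hX).sub hL.measurable_cL).max (hL.measurable_cR.sub (hL.hR.comp hX))

lemma measurable_mHat (hL : MeasurableFit L) :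
    Measurable fun p : (𝒯 × ℝ) × Obs k => (L p.1.1).mHat p.1.2 (X p.2) (D p.2) :=
  measurable_bool_rec (g := fun b (p : (𝒯 × ℝ) × Obs k) => (L p.1.1).mHat p.1.2 (X p.2) b)
    (fun b => (hL.mHat b).comp ((measurable_fst.comp measurable_fst).prodMk
      ((measurable_snd.comp measurable_fst).prodMk (measurable_X.comp measurable_snd))))
    (measurable_D.comp measurable_snd)

lemma measurable_piHat (hL : MeasurableFit L) :
    Measurable fun p : 𝒯 × Obs k => (L p.1).piHat (X p.2) (D p.2) :=
  measurable_bool_rec (g := fun b (p : 𝒯 × Obs k) => (L p.1).piHat (X p.2) b)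
    (fun b => (hL.piHat b).comp (measurable_fst.prodMk (measurable_X.comp measurable_snd)))
    (measurable_D.comp measurable_snd)

lemma measurable_psi (hL : MeasurableFit L) (γ : ℝ) :
    Measurable fun p : (𝒯 × ℝ) × Obs k => (L p.1.1).psi γ p.1.2 p.2 := by
  have hr : Measurable fun p : (𝒯 × ℝ) × Obs k => if R p.2 then (1 : ℝ) else 0 :=
    Measurable.ite ((measurable_R.comp measurable_snd) (measurableSet_singleton true))
      measurable_const measurable_const
  have hto : Measurable fun p : (𝒯 × ℝ) × Obs k => (p.1.1, p.2) :=
    (measurable_fst.comp measurable_fst).prodMk measurable_snd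
  have hV : Measurable fun p : (𝒯 × ℝ) × Obs k =>
      @ite ℝ ((L p.1.1).score p.2 < p.1.2) (Classical.propDecidable _) 1 0 :=
    Measurable.ite (measurableSet_lt (hL.measurable_score.comp hto)
      (measurable_snd.comp measurable_fst)) measurable_const measurable_const
  exact ((measurable_const.sub hr).mul (hL.measurable_mHat.sub_const _)).add
    ((hr.div (hL.measurable_piHat.comp hto)).mul (hV.sub hL.measurable_mHat))

end MeasurableFit

variable {F : Fit k}

lemma Fit.measurable_score (hF : MeasurableFit fun _ : Unit => F) : Measurable F.score :=
  hF.measurable_score.comp (measurable_prodMk_left (x := ()))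

lemma Fit.measurable_mHat (hF : MeasurableFit fun _ : Unit => F) (η : ℝ) :
    Measurable fun o : Obs k => F.mHat η (X o) (D o) :=
  hF.measurable_mHat.comp (measurable_prodMk_left (x := ((), η)))

lemma Fit.measurable_piHat (hF : MeasurableFit fun _ : Unit => F) :
    Measurable fun o : Obs k => F.piHat (X o) (D o) :=
  hF.measurable_piHat.comp (measurable_prodMk_left (x := ()))

lemma Fit.measurable_psi (hF : MeasurableFit fun _ : Unit => F) (γ η : ℝ) :
    Measurable (F.psi γ η) :=
  (hF.measurable_psi γ).comp (measurable_prodMk_left (x := ((), η)))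

end Measurability

/-! ### Uniform concentration of the sample moments -/

section Concentration

variable {k : ℕ} (F : Fit k)

/-- The weight of the indicator of `score < η` in `psi`. -/
noncomputable def Fit.indicatorWeight (o : Obs k) : ℝ :=
  (if R o then 1 else 0) / F.piHat (X o) (D o)

/-- The weight of `mHat` in `psi`. -/
noncomputable def Fit.mHatWeight (o : Obs k) : ℝ :=
  (1 - (if R o then 1 else 0)) - F.indicatorWeight o

open Classical in
/-- The increasing families of which `psi` is a signed combination, up to scaling by `B`. -/
noncomputable def Fit.component (γ m₀ B : ℝ) : Fin 5 → ℝ → Obs k → ℝ := fun r η o =>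
  match r with
  | 0 => max (F.mHatWeight o) 0 * (F.mHat η (X o) (D o) + m₀) / B
  | 1 => max (-F.mHatWeight o) 0 * (F.mHat η (X o) (D o) + m₀) / B
  | 2 => max (F.indicatorWeight o) 0 * (if F.score o < η then 1 else 0) / B
  | 3 => max (-F.indicatorWeight o) 0 * (if F.score o < η then 1 else 0) / B
  | 4 => (-((1 - (if R o then 1 else 0)) * (1 - γ)) - m₀ * F.mHatWeight o + B / 2) / B

/-- The signs with which the components enter `psi`. -/
def componentSign : Fin 5 → ℝ := ![1, -1, 1, -1, 1]

lemma abs_componentSign_le (r : Fin 5) : |componentSign r| ≤ 1 := by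
  fin_cases r <;> simp [componentSign]

/-- The weights of `mHat` and of the indicator may have either sign, so each is split into positive
and negative parts. Adding m₀ makes `mHat` nonnegative; the last component undoes this shift,
carries the part free of η, and is centred by B/2. -/
lemma Fit.psi_eq_sum_component {B : ℝ} (hB : B ≠ 0) (γ m₀ η : ℝ) (o : Obs k) :
    F.psi γ η o = -(B / 2) + B * ∑ r, componentSign r * F.component γ m₀ B r η o := by
  have h1 := max_zero_sub_max_neg_zero_eq_self (F.mHatWeight o)
  have h2 := max_zero_sub_max_neg_zero_eq_self (F.indicatorWeight o)
  simp only [Fin.sum_univ_five, componentSign, component]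
  simp only [Matrix.cons_val]
  have e : F.psi γ η o = -((1 - (if R o then 1 else 0)) * (1 - γ))
      + (max (F.mHatWeight o) 0 - max (-F.mHatWeight o) 0) * F.mHat η (X o) (D o)
      + (max (F.indicatorWeight o) 0 - max (-F.indicatorWeight o) 0)
        * @ite ℝ (F.score o < η) (Classical.propDecidable _) 1 0 := by
    rw [h1, h2]; simp only [psi, mHatWeight, indicatorWeight]; ring
  rw [e]
  field_simp
  nth_rewrite 5 [← h1]
  ring

variable {F}

lemma Fit.Regular.abs_indicatorWeight_le {m₀ π₀ : ℝ} (hF : F.Regular m₀ π₀) (hπ : 0 < π₀)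
    (o : Obs k) : |F.indicatorWeight o| ≤ π₀⁻¹ := by
  have h := hF.lower (X o) (D o)
  unfold indicatorWeight
  rw [abs_div]
  split_ifs
  · rw [abs_one, one_div]; exact inv_anti₀ hπ h
  · simp [hπ.le]

/-- The weight is −1/π̂ for respondents and 1 for attrited units; the latter is where π₀ ≤ 1 enters.
-/
lemma Fit.Regular.abs_mHatWeight_le {m₀ π₀ : ℝ} (hF : F.Regular m₀ π₀) (hπ : 0 < π₀)
    (hπ1 : π₀ ≤ 1) (o : Obs k) : |F.mHatWeight o| ≤ π₀⁻¹ := by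
  have h := hF.abs_indicatorWeight_le hπ o
  unfold mHatWeight
  unfold indicatorWeight at h ⊢
  split_ifs at h ⊢
  · simpa using h
  · simpa using (one_le_inv₀ hπ).2 hπ1

lemma Fit.Regular.nonneg {m₀ π₀ : ℝ} (hF : F.Regular m₀ π₀) : 0 ≤ m₀ :=
  (abs_nonneg _).trans (hF.bound 0 0 true)

lemma Fit.measurable_indicatorWeight (hF : MeasurableFit fun _ : Unit => F) :
    Measurable F.indicatorWeight :=
  (Measurable.ite (measurable_R (measurableSet_singleton true)) measurable_const
    measurable_const).div (measurable_piHat hF)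

lemma Fit.measurable_mHatWeight (hF : MeasurableFit fun _ : Unit => F) :
    Measurable F.mHatWeight :=
  (measurable_const.sub (Measurable.ite (measurable_R (measurableSet_singleton true))
    measurable_const measurable_const)).sub (measurable_indicatorWeight hF)

lemma Fit.measurable_component (hF : MeasurableFit fun _ : Unit => F) (γ m₀ B : ℝ) (r : Fin 5)
    (η : ℝ) : Measurable (F.component γ m₀ B r η) := by
  have hw := measurable_mHatWeight hF
  have hv := measurable_indicatorWeight hF
  have hm := measurable_mHat hF η
  have hV : Measurable fun o : Obs k => @ite ℝ (F.score o < η) (Classical.propDecidable _) 1 0 :=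
    Measurable.ite (measurableSet_lt (measurable_score hF) measurable_const) measurable_const
      measurable_const
  have hr : Measurable fun o : Obs k => if R o then (1 : ℝ) else 0 :=
    Measurable.ite (measurable_R (measurableSet_singleton true)) measurable_const measurable_const
  fin_cases r
  · exact ((hw.max measurable_const).mul (hm.add_const _)).div_const _
  · exact ((hw.neg.max measurable_const).mul (hm.add_const _)).div_const _
  · exact ((hv.max measurable_const).mul hV).div_const _
  · exact ((hv.neg.max measurable_const).mul hV).div_const _
  · exact (((((measurable_const.sub hr).mul_const _).neg).sub (hw.const_mul _)).add_const
      _).div_const _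

lemma Fit.Regular.monotone_component {m₀ π₀ : ℝ} (hF : F.Regular m₀ π₀) {γ B : ℝ} (hB : 0 < B)
    (r : Fin 5) : Monotone (F.component γ m₀ B r) := by
  intro η η' h o
  have hm : F.mHat η (X o) (D o) ≤ F.mHat η' (X o) (D o) := hF.mono _ _ h
  have hV : @ite ℝ (F.score o < η) (Classical.propDecidable _) 1 0
      ≤ @ite ℝ (F.score o < η') (Classical.propDecidable _) 1 0 := by
    by_cases h1 : F.score o < η
    · rw [if_pos h1, if_pos (h1.trans_le h)]
    · rw [if_neg h1]; split_ifs <;> simp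
  fin_cases r
  · exact div_le_div_of_nonneg_right (mul_le_mul_of_nonneg_left (by linarith)
      (le_max_right _ _)) hB.le
  · exact div_le_div_of_nonneg_right (mul_le_mul_of_nonneg_left (by linarith)
      (le_max_right _ _)) hB.le
  · exact div_le_div_of_nonneg_right (mul_le_mul_of_nonneg_left hV (le_max_right _ _)) hB.le
  · exact div_le_div_of_nonneg_right (mul_le_mul_of_nonneg_left hV (le_max_right _ _)) hB.le
  · exact le_rfl

lemma mul_div_mem_Icc {a b A C B : ℝ} (ha : 0 ≤ a) (haA : a ≤ A) (hb : 0 ≤ b) (hbC : b ≤ C)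
    (hB : 0 < B) (h : A * C ≤ B) : a * b / B ∈ Set.Icc (0 : ℝ) 1 :=
  ⟨by positivity, (div_le_one hB).2
    ((mul_le_mul haA hbC hb (ha.trans haA)).trans h)⟩

/-- The scale B = 2π₀⁻¹(1 + m₀) dominates weight times range, 2m₀π₀⁻¹ for `mHat` and π₀⁻¹ for the
indicator. The part free of η is at most π₀⁻¹(1 + m₀) = B/2 in absolute value, so the shift by B/2
puts it in [0, B]. -/
lemma Fit.Regular.component_mem_Icc {m₀ π₀ : ℝ} (hF : F.Regular m₀ π₀) (hπ : 0 < π₀)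
    (hπ1 : π₀ ≤ 1) {γ : ℝ} (hγ0 : 0 < γ) (hγ1 : γ < 1) (r : Fin 5) (η : ℝ) (o : Obs k) :
    F.component γ m₀ (2 * (π₀⁻¹ * (1 + m₀))) r η o ∈ Set.Icc (0 : ℝ) 1 := by
  have hm := abs_le.1 (hF.bound η (X o) (D o))
  have hm0 := hF.nonneg
  have hi : 1 ≤ π₀⁻¹ := (one_le_inv₀ hπ).2 hπ1
  have hw := abs_le.1 (hF.abs_mHatWeight_le hπ hπ1 o)
  have hv := abs_le.1 (hF.abs_indicatorWeight_le hπ o)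
  have hB : 0 < 2 * (π₀⁻¹ * (1 + m₀)) := by positivity
  have hV0 : 0 ≤ @ite ℝ (F.score o < η) (Classical.propDecidable _) 1 0 := by
    split_ifs <;> simp
  have hV1 : @ite ℝ (F.score o < η) (Classical.propDecidable _) 1 0 ≤ 1 := by
    split_ifs <;> simp
  have hA : π₀⁻¹ * (2 * m₀) ≤ 2 * (π₀⁻¹ * (1 + m₀)) := by nlinarith
  have hA' : π₀⁻¹ * 1 ≤ 2 * (π₀⁻¹ * (1 + m₀)) := by nlinarith
  fin_cases r
  · exact mul_div_mem_Icc (le_max_right _ _) (max_le hw.2 (by linarith)) (by linarith)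
      (by linarith) hB hA
  · exact mul_div_mem_Icc (le_max_right _ _) (max_le (by linarith) (by linarith)) (by linarith)
      (by linarith) hB hA
  · exact mul_div_mem_Icc (le_max_right _ _) (max_le hv.2 (by linarith)) hV0 hV1 hB hA'
  · exact mul_div_mem_Icc (le_max_right _ _) (max_le (by linarith) (by linarith)) hV0 hV1 hB hA'
  · have hr : |(1 - (if R o then (1 : ℝ) else 0)) * (1 - γ)| ≤ π₀⁻¹ := by
      split_ifs
      · simp; linarith
      · simp only [sub_zero, one_mul]; rw [abs_le]; constructor <;> linarith
    have hr := abs_le.1 hr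
    have h1 : m₀ * F.mHatWeight o ≤ m₀ * π₀⁻¹ := mul_le_mul_of_nonneg_left hw.2 hm0
    have h2 : m₀ * -π₀⁻¹ ≤ m₀ * F.mHatWeight o := mul_le_mul_of_nonneg_left hw.1 hm0
    change (-((1 - (if R o then (1 : ℝ) else 0)) * (1 - γ)) - m₀ * F.mHatWeight o
      + 2 * (π₀⁻¹ * (1 + m₀)) / 2) / (2 * (π₀⁻¹ * (1 + m₀))) ∈ Set.Icc (0 : ℝ) 1
    refine ⟨div_nonneg ?_ hB.le, (div_le_one hB).2 ?_⟩
    · nlinarith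
    · nlinarith

/-- The half-width of the uniform confidence band for the moment function. -/
noncomputable def bandWidth (m₀ π₀ δ : ℝ) (N : ℕ) : ℝ :=
  120 * (π₀⁻¹ * (1 + m₀)) * Real.sqrt ((Real.log (1 / δ) + 1) / N)

/-- The sample moments are uniformly close to their means. -/
theorem Fit.Regular.pi_exists_deviation_le {m₀ π₀ : ℝ} (hreg : F.Regular m₀ π₀)
    (hF : MeasurableFit fun _ : Unit => F) (hπ : 0 < π₀) (hπ1 : π₀ ≤ 1) {γ : ℝ} (hγ0 : 0 < γ)
    (hγ1 : γ < 1) (Q : Measure (Obs k)) [IsProbabilityMeasure Q] {N : ℕ} (hN : 0 < N) {δ : ℝ}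
    (hδ : 0 < δ) (hδ1 : δ ≤ 1) :
    (Measure.pi fun _ : Fin N => Q)
        {s | ∃ η, N * bandWidth m₀ π₀ δ N < |∑ i, (F.psi γ η (s i) - ∫ o, F.psi γ η o ∂Q)|}
      ≤ ENNReal.ofReal δ := by
  have hm0 := hreg.nonneg
  have hB : 0 < 2 * (π₀⁻¹ * (1 + m₀)) := by positivity
  have hNr : (0 : ℝ) < N := Nat.cast_pos.2 hN
  have hlog : 0 ≤ Real.log (1 / δ) := Real.log_nonneg ((one_le_div hδ).2 hδ1)
  set w := Real.sqrt ((Real.log (1 / δ) + 1) / N) with hw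
  have hwpos : 0 < w := Real.sqrt_pos.2 (by positivity)
  have hwsq : N * w ^ 2 = Real.log (1 / δ) + 1 := by
    rw [hw, Real.sq_sqrt (by positivity)]; field_simp
  -- Five components at u = 12w give the width 2 · 5 · 12 = 120. The failure probability is 5 · 8 ·
  -- exp(−4.5 (log(1/δ) + 1)) ≤ 40 e⁻⁴ δ ≤ δ.
  have h := pi_exists_abs_deviation_combination_le (N := N) (Q := Q)
    (f := F.component γ m₀ (2 * (π₀⁻¹ * (1 + m₀)))) (measurable_component hF _ _ _)
    (hreg.monotone_component hB) (hreg.component_mem_Icc hπ hπ1 hγ0 hγ1) abs_componentSign_le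
    hB.le (fun η o => F.psi_eq_sum_component hB.ne' γ m₀ η o) (u := 12 * w) (by positivity)
  have e : 2 * (π₀⁻¹ * (1 + m₀)) * (Fintype.card (Fin 5) * (N * (12 * w)))
      = N * bandWidth m₀ π₀ δ N := by
    rw [bandWidth, ← hw]; simp; ring
  rw [e] at h
  refine h.trans ?_
  rw [Fintype.card_fin, ← ENNReal.ofReal_natCast, ← ENNReal.ofReal_mul (by positivity)]
  refine ENNReal.ofReal_le_ofReal ?_
  have h4 : Real.exp (-(N * (12 * w) ^ 2 / 32)) ≤ Real.exp (-4) * δ := by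
    rw [← Real.exp_log hδ, ← Real.exp_add]
    refine Real.exp_le_exp.2 ?_
    rw [one_div, Real.log_inv] at hwsq hlog
    nlinarith
  have h5 : Real.exp (-4) ≤ 1 / 40 := by
    rw [Real.exp_neg, ← one_div]
    refine one_div_le_one_div_of_le (by norm_num) ?_
    have h27 := Real.exp_one_gt_d9
    have : Real.exp 4 = Real.exp 1 ^ 4 := by rw [← Real.exp_nat_mul]; norm_num
    rw [this]
    calc (40 : ℝ) ≤ 2.7 ^ 4 := by norm_num
      _ ≤ _ := pow_le_pow_left₀ (by norm_num) (by linarith) 4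
  push_cast
  nlinarith

end Concentration

/-! ### Identification under missingness at random, and double robustness -/

section Identification

variable {k : ℕ} {Q : Measure (Obs k)}

/-- The responding unit with given covariates, treatment and potential outcomes. -/
def fill (p : (Cov k × Bool) × ℝ × ℝ) : Obs k := (p.1.1, p.2.1, p.2.2, p.1.2, true)

lemma measurable_fill : Measurable (fill (k := k)) := by
  unfold fill; fun_prop

/-- The same unit with its response set to `true`. -/
def respond (o : Obs k) : Obs k := fill (XD o, potential o)

/-- Such a function factors through `XD`, which `respond` preserves. Invariance under `respond`
expresses dependence on (X, D, Y(1), Y(0)) only. -/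
lemma eq_respond_of_measurable {f : Obs k → ℝ} (hf : Measurable[sigmaXD k] f) (o : Obs k) :
    f (respond o) = f o :=
  (Measurable.factorsThrough (f := XD) (g := f) hf) rfl

lemma measurableSet_R (b : Bool) : MeasurableSet {o : Obs k | R o = b} :=
  measurable_R (measurableSet_singleton b)

lemma measurable_eR : Measurable[sigmaXD k] (eR Q) := stronglyMeasurable_condExp.measurable

lemma integrable_eR : Integrable (eR Q) Q := integrable_condExp

lemma measurable_eR' : Measurable (eR Q) := measurable_eR.mono sigmaXD_le le_rfl

lemma Overlap.eR_pos (h : Overlap Q) : ∀ᵐ o ∂Q, 0 < eR Q o := by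
  obtain ⟨c, hc, -, h⟩ := h
  filter_upwards [h] with o ho using hc.trans ho.1

lemma Overlap.eR_lt_one (h : Overlap Q) : ∀ᵐ o ∂Q, eR Q o < 1 := by
  obtain ⟨c, hc, -, h⟩ := h
  filter_upwards [h] with o ho using by linarith [ho.2]

lemma measurable_piR : Measurable (piR Q) :=
  measurable_eR'.div (measurable_const.sub measurable_eR')

variable {F : Fit k}

lemma Fit.measurable_mC (η : ℝ) : Measurable[sigmaXD k] (F.mC Q η) :=
  stronglyMeasurable_condExp.measurable

lemma Fit.measurable_mC' (η : ℝ) : Measurable (F.mC Q η) :=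
  (F.measurable_mC η).mono sigmaXD_le le_rfl

lemma Fit.Regular.abs_inv_piHat_le {m₀ π₀ : ℝ} (hreg : F.Regular m₀ π₀) (hπ : 0 < π₀)
    (o : Obs k) : |(F.piHat (X o) (D o))⁻¹| ≤ π₀⁻¹ := by
  rw [abs_inv]; exact inv_anti₀ hπ (hreg.lower _ _)

/-- Cauchy–Schwarz, after bounding 1 − e_R by 1 and |π̂⁻¹| by π₀⁻¹. Working in `ℝ≥0∞` allows
infinite errors. -/
lemma Fit.Regular.ofReal_abs_bias_le {m₀ π₀ : ℝ} (hreg : F.Regular m₀ π₀)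
    (hF : MeasurableFit fun _ : Unit => F) (hπ : 0 < π₀) (hO : Overlap Q) (η : ℝ) :
    ENNReal.ofReal |∫ o, (1 - eR Q o) * (F.piHat (X o) (D o))⁻¹
          * ((F.mHat η (X o) (D o) - F.mC Q η o) * (F.piHat (X o) (D o) - piR Q o)) ∂Q|
      ≤ ENNReal.ofReal π₀⁻¹ * (F.piError Q * F.mError Q) := by
  set a : Obs k → ℝ := fun o => F.mHat η (X o) (D o) - F.mC Q η o with ha
  set b : Obs k → ℝ := fun o => F.piHat (X o) (D o) - piR Q o with hb
  have ham : AEStronglyMeasurable a Q :=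
    ((Fit.measurable_mHat hF η).sub (F.measurable_mC' η)).aestronglyMeasurable
  have hbm : AEStronglyMeasurable b Q :=
    ((Fit.measurable_piHat hF).sub measurable_piR).aestronglyMeasurable
  have hHolder : eLpNorm (b • a) 1 Q ≤ eLpNorm b 2 Q * eLpNorm a 2 Q :=
    eLpNorm_smul_le_mul_eLpNorm ham hbm
  have h1 : eLpNorm (b • a) 1 Q ≤ F.piError Q * F.mError Q :=
    hHolder.trans (mul_le_mul' le_rfl (le_iSup
      (fun η : ℝ => eLpNorm (fun o => F.mHat η (X o) (D o) - F.mC Q η o) 2 Q) η))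
  rw [eLpNorm_one_eq_lintegral_enorm] at h1
  refine le_trans ?_ (mul_le_mul' le_rfl h1)
  rw [← Real.enorm_eq_ofReal_abs, ← lintegral_const_mul' _ _ ENNReal.ofReal_ne_top]
  refine (enorm_integral_le_lintegral_enorm _).trans (lintegral_mono_ae ?_)
  filter_upwards [hO.eR_pos, hO.eR_lt_one] with o h0 h1
  rw [enorm_mul]
  refine mul_le_mul' ?_ (le_of_eq ?_)
  · rw [Real.enorm_eq_ofReal_abs, abs_mul]
    refine ENNReal.ofReal_le_ofReal ?_
    refine (mul_le_of_le_one_left (abs_nonneg _) ?_).trans (hreg.abs_inv_piHat_le hπ o)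
    rw [abs_le]; constructor <;> linarith
  · rw [Pi.smul_apply', smul_eq_mul, mul_comm]

variable [IsProbabilityMeasure Q]

lemma setIntegral_one_eq_real {μ : Measure (Obs k)} {s t : Set (Obs k)}
    (ht : MeasurableSet t) : ∫ o in s, t.indicator (fun _ => (1 : ℝ)) o ∂μ = μ.real (t ∩ s) := by
  rw [integral_indicator ht]
  simp [measureReal_restrict_apply, ht]

/-- Conditional independence gives P(T, R = 1 | X, D) = P(T | X, D) e_R; as e_R is σ(X,
D)-measurable, it can be pulled inside the conditional expectation before integrating over S. -/
lemma MissingAtRandom.setIntegral_indicator_mul_eR (hM : MissingAtRandom Q) {S : Set (Cov k × Bool)}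
    {T : Set (ℝ × ℝ)} (hS : MeasurableSet S) (hT : MeasurableSet T) :
    ∫ o in XD ⁻¹' S, (potential ⁻¹' T).indicator (fun _ => (1 : ℝ)) o * eR Q o ∂Q
      = Q.real ((potential ⁻¹' T ∩ {o | R o = true}) ∩ XD ⁻¹' S) := by
  have hT' : MeasurableSet (potential (k := k) ⁻¹' T) := measurable_potential hT
  have hS' : MeasurableSet[sigmaXD k] (XD (k := k) ⁻¹' S) := ⟨S, hS, rfl⟩
  have hint : ∀ A : Set (Obs k), MeasurableSet A →
      Integrable (A.indicator fun _ => (1 : ℝ)) Q := fun A hA => (integrable_const 1).indicator hA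
  have hprod : Integrable ((potential ⁻¹' T).indicator (fun _ => (1 : ℝ)) * eR Q) Q := by
    have : (potential ⁻¹' T).indicator (fun _ => (1 : ℝ)) * eR Q
        = (potential ⁻¹' T).indicator (eR Q) := by
      ext o; by_cases h : o ∈ potential ⁻¹' T <;> simp [h]
    rw [this]
    exact integrable_condExp.indicator hT'
  have h1 := (condIndepFun_iff_condExp_inter_preimage_eq_mul measurable_potential measurable_R).1
    hM T {true} hT (measurableSet_singleton true)
  have h2 := condExp_mul_of_stronglyMeasurable_right (m := sigmaXD k) (μ := Q)
    (measurable_eR (Q := Q)).stronglyMeasurable hprod (hint _ hT')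
  have hE : MeasurableSet (potential (k := k) ⁻¹' T ∩ {o | R o = true}) :=
    hT'.inter (measurableSet_R true)
  rw [← setIntegral_one_eq_real hE, ← setIntegral_condExp sigmaXD_le (hint _ hE) hS']
  have h3 := setIntegral_condExp sigmaXD_le hprod hS'
  simp only [Pi.mul_apply] at h3
  rw [← h3]
  refine integral_congr_ae (ae_restrict_of_ae ?_)
  filter_upwards [h1, h2] with o h1 h2
  rw [h2]
  exact h1.symm

/-- On rectangles this is `MissingAtRandom.setIntegral_indicator_mul_eR`, and rectangles determine
the measure: for functions of (X, D, Y(1), Y(0)), restricting to respondents is weighting by e_R. -/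
lemma MissingAtRandom.map_restrict_eq (hM : MissingAtRandom Q) (hO : Overlap Q) :
    (Q.restrict {o | R o = true}).map (fun o => (XD o, potential o))
      = (Q.withDensity fun o => ENNReal.ofReal (eR Q o)).map (fun o => (XD o, potential o)) := by
  have hΦ : Measurable fun o : Obs k => (XD o, potential o) :=
    measurable_XD.prodMk measurable_potential
  refine Measure.ext_prod fun {S T} hS hT => ?_
  have hS' := measurable_XD (k := k) hS
  have hT' := measurable_potential (k := k) hT
  have hpre : (fun o : Obs k => (XD o, potential o)) ⁻¹' (S ×ˢ T)
      = XD ⁻¹' S ∩ potential ⁻¹' T := rfl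
  rw [Measure.map_apply hΦ (hS.prod hT), Measure.map_apply hΦ (hS.prod hT), hpre,
    Measure.restrict_apply (hS'.inter hT'), withDensity_apply _ (hS'.inter hT'),
    ← ofReal_integral_eq_lintegral_ofReal integrable_eR.integrableOn
      (ae_restrict_of_ae (hO.eR_pos.mono fun o h => h.le)),
    ← ofReal_measureReal]
  congr 1
  have h := hM.setIntegral_indicator_mul_eR hS hT
  have e : (potential ⁻¹' T ∩ {o : Obs k | R o = true}) ∩ XD ⁻¹' S
      = XD ⁻¹' S ∩ potential ⁻¹' T ∩ {o | R o = true} := by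
    ext o; simp only [Set.mem_inter_iff]; tauto
  rw [e] at h
  rw [← h, ← setIntegral_indicator hT']
  refine integral_congr_ae (ae_of_all _ fun o => ?_)
  by_cases ho : o ∈ potential ⁻¹' T <;> simp [ho]

/-- Averages over respondents of functions of `(X, D, Y(1), Y(0))`. -/
lemma MissingAtRandom.setIntegral_respondents (hM : MissingAtRandom Q) (hO : Overlap Q)
    {h : Obs k → ℝ} (hm : Measurable h) (hr : ∀ o, h (respond o) = h o) :
    ∫ o in {o | R o = true}, h o ∂Q = ∫ o, eR Q o * h o ∂Q := by
  have hΦ : Measurable fun o : Obs k => (XD o, potential o) :=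
    measurable_XD.prodMk measurable_potential
  have hg : Measurable (h ∘ fill) := hm.comp measurable_fill
  have key : ∀ μ : Measure (Obs k), ∫ p, (h ∘ fill) p ∂(μ.map fun o => (XD o, potential o))
      = ∫ o, h o ∂μ := fun μ => by
    rw [integral_map hΦ.aemeasurable hg.aestronglyMeasurable]
    exact integral_congr_ae (ae_of_all _ hr)
  rw [← key, hM.map_restrict_eq hO, key, integral_withDensity_eq_integral_toReal_smul
    measurable_eR'.ennreal_ofReal (ae_of_all _ fun _ => ENNReal.ofReal_lt_top)]
  refine integral_congr_ae (hO.eR_pos.mono fun o ho => ?_)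
  simp [ENNReal.toReal_ofReal ho.le]

lemma compl_respondents : {o : Obs k | R o = true}ᶜ = {o | R o = false} := by
  ext o; simp

lemma MissingAtRandom.setIntegral_attrited (hM : MissingAtRandom Q) (hO : Overlap Q)
    {h : Obs k → ℝ} (hm : Measurable h) (hr : ∀ o, h (respond o) = h o) (hi : Integrable h Q) :
    ∫ o in {o | R o = false}, h o ∂Q = ∫ o, (1 - eR Q o) * h o ∂Q := by
  have h1 := integral_add_compl (measurableSet_R (k := k) true) hi
  rw [compl_respondents, hM.setIntegral_respondents hO hm hr] at h1
  have hi2 : Integrable (fun o => eR Q o * h o) Q := by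
    refine hi.bdd_mul (c := 1) measurable_eR'.aestronglyMeasurable ?_
    filter_upwards [hO.eR_pos, hO.eR_lt_one] with o h0 h1
    rw [Real.norm_of_nonneg h0.le]; exact h1.le
  have h2 : ∫ o, (1 - eR Q o) * h o ∂Q = ∫ o, h o ∂Q - ∫ o, eR Q o * h o ∂Q := by
    rw [← integral_sub hi hi2]
    exact integral_congr_ae (ae_of_all _ fun o => by simp; ring)
  linarith

lemma integral_eR : ∫ o, eR Q o ∂Q = Q.real {o | R o = true} := by
  unfold eR
  rw [integral_condExp sigmaXD_le, integral_indicator (measurableSet_R true)]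
  simp

lemma Overlap.respondents_pos (hO : Overlap Q) : 0 < Q.real {o | R o = true} := by
  obtain ⟨c, hc, -, h⟩ := hO
  rw [← integral_eR]
  have := integral_mono_ae (integrable_const c) (integrable_eR (Q := Q))
    (h.mono fun o ho => ho.1.le)
  simp at this
  linarith

lemma Overlap.probAttrition_pos (hO : Overlap Q) : 0 < probAttrition Q := by
  obtain ⟨c, hc, -, h⟩ := hO
  have h1 := integral_mono_ae (integrable_eR (Q := Q)) (integrable_const (1 - c))
    (h.mono fun o ho => ho.2.le)
  rw [integral_eR] at h1
  have h2 := probReal_add_probReal_compl (μ := Q) (measurableSet_R (k := k) true)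
  rw [compl_respondents] at h2
  unfold probAttrition
  simp at h1
  linarith

/-- `P(V_C < η | R = 1, X, D)` integrates like the indicator of `V_C < η` over respondents. -/
lemma Fit.setIntegral_mul_mC (hF : MeasurableFit fun _ : Unit => F) (hO : Overlap Q) (η : ℝ)
    {g : Obs k → ℝ} (hg : Measurable[sigmaXD k] g) {b : ℝ} (hb : ∀ᵐ o ∂Q, |g o| ≤ b) :
    ∫ o in {o | R o = true}, g o * F.mC Q η o ∂Q
      = ∫ o in {o | R o = true}, g o * {o | F.score o < η}.indicator (fun _ => (1 : ℝ)) o ∂Q := by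
  have hpos : Q {o | R o = true} ≠ 0 := by
    intro h0; have := hO.respondents_pos; rw [measureReal_def, h0] at this; simp at this
  have hcond : IsProbabilityMeasure (responding Q) := cond_isProbabilityMeasure hpos
  have hV : MeasurableSet {o | F.score o < η} :=
    measurableSet_lt (Fit.measurable_score hF) measurable_const
  have hVi : Integrable ({o | F.score o < η}.indicator fun _ => (1 : ℝ)) (responding Q) :=
    (integrable_const 1).indicator hV
  have hb' : ∀ᵐ o ∂(responding Q), ‖g o‖ ≤ b := cond_absolutelyContinuous.ae_le hb
  have hgm : AEStronglyMeasurable g (responding Q) :=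
    (hg.mono sigmaXD_le le_rfl).aestronglyMeasurable
  have h1 := condExp_mul_of_stronglyMeasurable_left (m := sigmaXD k) (μ := responding Q)
    hg.stronglyMeasurable (hVi.bdd_mul hgm hb') hVi
  have h2 : ∫ o, g o * F.mC Q η o ∂(responding Q)
      = ∫ o, g o * {o | F.score o < η}.indicator (fun _ => (1 : ℝ)) o ∂(responding Q) := by
    have h3 := integral_condExp (m := sigmaXD k) sigmaXD_le (μ := responding Q)
      (f := g * {o | F.score o < η}.indicator fun _ => (1 : ℝ))
    rw [integral_congr_ae h1] at h3
    exact h3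
  unfold responding ProbabilityTheory.cond at h2
  rw [integral_smul_measure, integral_smul_measure] at h2
  have hc : ((Q {o | R o = true})⁻¹).toReal ≠ 0 := by
    simp [ENNReal.toReal_eq_zero_iff, hpos]
  exact smul_right_injective ℝ hc h2

/-- As a conditional expectation given R = 1, `mC` is controlled only almost surely among
respondents. The exceptional set lies in σ(X, D), so its respondent mass is the integral of e_R over
it; since e_R > 0, it is null under `Q` too. -/
lemma Fit.mC_mem_Icc (hF : MeasurableFit fun _ : Unit => F) (hM : MissingAtRandom Q)
    (hO : Overlap Q) (η : ℝ) : ∀ᵐ o ∂Q, F.mC Q η o ∈ Set.Icc (0 : ℝ) 1 := by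
  have hpos : Q {o | R o = true} ≠ 0 := by
    intro h0; have := hO.respondents_pos; rw [measureReal_def, h0] at this; simp at this
  have hcond : IsProbabilityMeasure (responding Q) := cond_isProbabilityMeasure hpos
  have hV : MeasurableSet {o | F.score o < η} :=
    measurableSet_lt (Fit.measurable_score hF) measurable_const
  have hVi : Integrable ({o | F.score o < η}.indicator fun _ => (1 : ℝ)) (responding Q) :=
    (integrable_const 1).indicator hV
  have h0 : 0 ≤ᵐ[responding Q] F.mC Q η := condExp_nonneg (ae_of_all _ fun o =>
    Set.indicator_nonneg (fun _ _ => zero_le_one) o)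
  have h1 : F.mC Q η ≤ᵐ[responding Q] fun _ => (1 : ℝ) := by
    have h := condExp_mono (m := sigmaXD k) hVi (integrable_const (1 : ℝ))
      (ae_of_all _ fun o => Set.indicator_le_self' (fun _ _ => zero_le_one) o)
    rwa [condExp_const sigmaXD_le] at h
  set S : Set (Obs k) := (F.mC Q η) ⁻¹' (Set.Icc 0 1)ᶜ with hS
  have hSm : MeasurableSet[sigmaXD k] S := F.measurable_mC η measurableSet_Icc.compl
  have hSm' : MeasurableSet S := sigmaXD_le _ hSm
  have hnull : Q ({o | R o = true} ∩ S) = 0 := by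
    have hr : responding Q S = 0 := by
      have : ∀ᵐ o ∂(responding Q), o ∉ S := by
        filter_upwards [h0, h1] with o h0 h1 using fun h => h ⟨h0, h1⟩
      simpa [ae_iff] using this
    unfold responding at hr
    rw [cond_apply (measurableSet_R true)] at hr
    exact (mul_eq_zero.1 hr).resolve_left (by simp)
  have hind : Measurable[sigmaXD k] (S.indicator fun _ => (1 : ℝ)) :=
    measurable_const.indicator hSm
  have h2 := hM.setIntegral_respondents hO (hind.mono sigmaXD_le le_rfl)
    (eq_respond_of_measurable hind)
  rw [setIntegral_one_eq_real hSm', measureReal_def, Set.inter_comm, hnull,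
    ENNReal.toReal_zero] at h2
  have hnn : 0 ≤ᵐ[Q] fun o => eR Q o * S.indicator (fun _ => (1 : ℝ)) o :=
    hO.eR_pos.mono fun o ho => mul_nonneg ho.le (Set.indicator_nonneg (fun _ _ => zero_le_one) o)
  have hint : Integrable (fun o => eR Q o * S.indicator (fun _ => (1 : ℝ)) o) Q := by
    have : (fun o => eR Q o * S.indicator (fun _ => (1 : ℝ)) o) = S.indicator (eR Q) := by
      ext o; by_cases h : o ∈ S <;> simp [h]
    rw [this]
    exact integrable_eR.indicator hSm'
  have h3 := (integral_eq_zero_iff_of_nonneg_ae hnn hint).1 h2.symm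
  filter_upwards [h3, hO.eR_pos] with o h3 hpos'
  by_contra hcon
  have : o ∈ S := hcon
  simp [this] at h3
  linarith

/-- Weighting respondents by (1 − e_R)/e_R reproduces attrited averages. This weight is σ(X,
D)-measurable and bounded by overlap, so among respondents the indicator may be replaced by `mC`
before weighting back. -/
lemma Fit.integral_attrited_mC (hF : MeasurableFit fun _ : Unit => F) (hM : MissingAtRandom Q)
    (hO : Overlap Q) (η : ℝ) :
    Q.real ({o | F.score o < η} ∩ {o | R o = false}) = ∫ o, (1 - eR Q o) * F.mC Q η o ∂Q := by
  have hV : MeasurableSet {o | F.score o < η} :=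
    measurableSet_lt (Fit.measurable_score hF) measurable_const
  have hVm : Measurable ({o | F.score o < η}.indicator fun _ => (1 : ℝ)) :=
    measurable_const.indicator hV
  have hVr : ∀ o, {o | F.score o < η}.indicator (fun _ => (1 : ℝ)) (respond o)
      = {o | F.score o < η}.indicator (fun _ => (1 : ℝ)) o := fun o => rfl
  set g : Obs k → ℝ := fun o => (1 - eR Q o) / eR Q o with hgdef
  have hg : Measurable[sigmaXD k] g := (measurable_const.sub measurable_eR).div measurable_eR
  have hg' : Measurable g := hg.mono sigmaXD_le le_rfl
  obtain ⟨c, hc, -, hcO⟩ := id hO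
  have hgb : ∀ᵐ o ∂Q, |g o| ≤ c⁻¹ := by
    filter_upwards [hcO] with o ho
    rw [abs_of_nonneg (div_nonneg (by linarith) (by linarith)), inv_eq_one_div]
    exact div_le_div₀ zero_le_one (by linarith) hc ho.1.le
  have hge : ∀ h : Obs k → ℝ, ∫ o, eR Q o * (g o * h o) ∂Q = ∫ o, (1 - eR Q o) * h o ∂Q :=
    fun h => integral_congr_ae (hO.eR_pos.mono fun o ho => by
      simp only [hgdef]; field_simp)
  rw [← setIntegral_one_eq_real hV,
    hM.setIntegral_attrited hO hVm hVr ((integrable_const 1).indicator hV), ← hge, ← hge,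
    ← hM.setIntegral_respondents (h := fun o => g o * _) hO (hg'.mul hVm) (fun o => by
      rw [eq_respond_of_measurable hg, hVr]),
    ← hM.setIntegral_respondents (h := fun o => g o * _) hO
      (hg'.mul (F.measurable_mC' η)) (fun o => by
      rw [eq_respond_of_measurable hg, eq_respond_of_measurable (F.measurable_mC η)])]
  exact (Fit.setIntegral_mul_mC hF hO η hg hgb).symm

lemma Fit.Regular.integrable_psi {m₀ π₀ : ℝ} (hreg : F.Regular m₀ π₀)
    (hF : MeasurableFit fun _ : Unit => F) (hπ : 0 < π₀) (γ η : ℝ) :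
    Integrable (F.psi γ η) Q := by
  refine Integrable.of_bound (Fit.measurable_psi hF γ η).aestronglyMeasurable
    ((m₀ + |1 - γ|) + π₀⁻¹ * (1 + m₀)) (ae_of_all _ fun o => ?_)
  have hm := hreg.bound η (X o) (D o)
  have hm0 := hreg.nonneg
  have h1 := abs_nonneg (1 - γ)
  rw [Real.norm_eq_abs]
  by_cases hR : R o = true
  · simp only [Fit.psi, hR, if_true, sub_self, zero_mul, zero_add, one_div]
    rw [abs_mul]
    have h2 : |(@ite ℝ (F.score o < η) (Classical.propDecidable _) 1 0)
        - F.mHat η (X o) (D o)| ≤ 1 + m₀ := by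
      refine (abs_sub _ _).trans (add_le_add ?_ hm)
      split_ifs <;> simp
    have h3 := mul_le_mul (hreg.abs_inv_piHat_le hπ o) h2 (abs_nonneg _) (by positivity)
    linarith
  · simp only [Fit.psi, hR]
    simp only [Bool.false_eq_true, if_false, sub_zero, one_mul, zero_div, zero_mul, add_zero]
    have h2 := abs_sub (F.mHat η (X o) (D o)) (1 - γ)
    have : 0 ≤ π₀⁻¹ * (1 + m₀) := by positivity
    linarith

lemma measurable_comp_XD {g : Cov k × Bool → ℝ} (hg : Measurable g) :
    Measurable[sigmaXD k] fun o => g (XD o) :=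
  hg.comp (comap_measurable XD)

lemma Fit.measurable_piHat_sigmaXD (hF : MeasurableFit fun _ : Unit => F) :
    Measurable[sigmaXD k] fun o : Obs k => F.piHat (X o) (D o) :=
  measurable_comp_XD (g := fun p => F.piHat p.1 p.2)
    (measurable_bool_rec (g := fun b (p : Cov k × Bool) => F.piHat p.1 b)
      (fun b => (hF.piHat b).comp (measurable_const.prodMk measurable_fst : Measurable
          fun p : Cov k × Bool => ((), p.1))) measurable_snd)

/-- The mean of the estimated influence function equals the coverage deficit up to a product of
the errors of the two nuisance estimates. -/
lemma Fit.Regular.integral_psi {m₀ π₀ : ℝ} (hreg : F.Regular m₀ π₀)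
    (hF : MeasurableFit fun _ : Unit => F) (hπ : 0 < π₀) (hM : MissingAtRandom Q)
    (hO : Overlap Q) (γ η : ℝ) :
    ∫ o, F.psi γ η o ∂Q
      = Q.real ({o | F.score o < η} ∩ {o | R o = false}) - probAttrition Q * (1 - γ)
        + ∫ o, (1 - eR Q o) * (F.piHat (X o) (D o))⁻¹
          * ((F.mHat η (X o) (D o) - F.mC Q η o) * (F.piHat (X o) (D o) - piR Q o)) ∂Q := by
  set mh : Obs k → ℝ := fun o => F.mHat η (X o) (D o) with hmh
  set iv : Obs k → ℝ := fun o => (F.piHat (X o) (D o))⁻¹ with hiv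
  set m : Obs k → ℝ := F.mC Q η with hm
  set V : Obs k → ℝ := {o | F.score o < η}.indicator fun _ => (1 : ℝ) with hV
  have hVs : MeasurableSet {o | F.score o < η} :=
    measurableSet_lt (Fit.measurable_score hF) measurable_const
  have hVm : Measurable V := measurable_const.indicator hVs
  have hmhm : Measurable mh := Fit.measurable_mHat hF η
  have hivm : Measurable[sigmaXD k] iv := (Fit.measurable_piHat_sigmaXD hF).inv
  have hivm' : Measurable iv := (Fit.measurable_piHat hF).inv
  have hmm : Measurable m := F.measurable_mC' η
  have hmhb : ∀ o, |mh o| ≤ m₀ := fun o => hreg.bound _ _ _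
  have hivb : ∀ o, |iv o| ≤ π₀⁻¹ := hreg.abs_inv_piHat_le hπ
  have hmhi : Integrable mh Q :=
    Integrable.of_bound hmhm.aestronglyMeasurable m₀ (ae_of_all _ hmhb)
  have hmi : Integrable m Q := Integrable.of_bound hmm.aestronglyMeasurable 1
    ((Fit.mC_mem_Icc hF hM hO η).mono fun o ho => by
      rw [Real.norm_of_nonneg ho.1]; exact ho.2)
  have hVi : Integrable V Q := (integrable_const 1).indicator hVs
  have heb : ∀ᵐ o ∂Q, ‖eR Q o‖ ≤ 1 := by
    filter_upwards [hO.eR_pos, hO.eR_lt_one] with o h0 h1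
    rw [Real.norm_of_nonneg h0.le]; exact h1.le
  have heb' : ∀ᵐ o ∂Q, ‖1 - eR Q o‖ ≤ 1 := by
    filter_upwards [hO.eR_pos, hO.eR_lt_one] with o h0 h1
    rw [Real.norm_of_nonneg (by linarith)]; linarith
  have hiI : ∀ {h : Obs k → ℝ}, Integrable h Q → Integrable (fun o => iv o * h o) Q := fun hh =>
    hh.bdd_mul hivm'.aestronglyMeasurable (ae_of_all _ hivb)
  have heI : ∀ {h : Obs k → ℝ}, Integrable h Q → Integrable (fun o => eR Q o * h o) Q := fun hh =>
    hh.bdd_mul measurable_eR'.aestronglyMeasurable heb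
  have heI' : ∀ {h : Obs k → ℝ}, Integrable h Q → Integrable (fun o => (1 - eR Q o) * h o) Q :=
    fun hh => hh.bdd_mul (measurable_const.sub measurable_eR').aestronglyMeasurable heb'
  have hsplit := integral_add_compl (measurableSet_R (k := k) true)
    (hreg.integrable_psi (Q := Q) hF hπ γ η)
  rw [compl_respondents] at hsplit
  have hfalse : ∫ o in {o | R o = false}, F.psi γ η o ∂Q
      = ∫ o, (1 - eR Q o) * mh o ∂Q - probAttrition Q * (1 - γ) := by
    have h1 : ∫ o in {o | R o = false}, F.psi γ η o ∂Q
        = ∫ o in {o | R o = false}, (mh o - (1 - γ)) ∂Q := by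
      refine setIntegral_congr_fun (measurableSet_R false) fun o ho => ?_
      have ho : R o = false := ho
      simp [Fit.psi, ho, hmh]
    rw [h1, integral_sub hmhi.integrableOn (integrable_const _),
      hM.setIntegral_attrited hO hmhm (fun o => rfl) hmhi]
    simp [probAttrition]
  have htrue : ∫ o in {o | R o = true}, F.psi γ η o ∂Q
      = ∫ o, eR Q o * (iv o * (m o - mh o)) ∂Q := by
    have h1 : ∫ o in {o | R o = true}, F.psi γ η o ∂Q
        = ∫ o in {o | R o = true}, (iv o * V o - iv o * mh o) ∂Q := by
      refine setIntegral_congr_fun (measurableSet_R true) fun o ho => ?_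
      have ho : R o = true := ho
      simp only [Fit.psi, ho, hmh, hiv, hV, Set.indicator_apply]
      simp only [if_true, sub_self, zero_mul, zero_add, one_div, mul_sub]
      rfl
    rw [h1, integral_sub (hiI hVi).integrableOn (hiI hmhi).integrableOn,
      ← Fit.setIntegral_mul_mC hF hO η hivm (ae_of_all _ hivb),
      ← integral_sub (hiI hmi).integrableOn (hiI hmhi).integrableOn]
    have h2 := hM.setIntegral_respondents hO (h := fun o => iv o * m o - iv o * mh o)
      ((hivm'.mul hmm).sub (hivm'.mul hmhm)) (fun o => by
        rw [eq_respond_of_measurable hivm, hm, eq_respond_of_measurable (F.measurable_mC η)]; rfl)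
    rw [h2]
    simp only [mul_sub]
  rw [← hsplit, hfalse, htrue, Fit.integral_attrited_mC hF hM hO η]
  have hI1 : Integrable (fun o => (1 - eR Q o) * (mh o - m o)) Q := heI' (hmhi.sub hmi)
  have hI2 : Integrable (fun o => eR Q o * (iv o * (m o - mh o))) Q := heI (hiI (hmi.sub hmhi))
  -- Since (1 − e_R) π = e_R, the factor (1 − e_R) π̂⁻¹ (π̂ − π) equals (1 − e_R) − e_R π̂⁻¹.
  have hbias : ∫ o, (1 - eR Q o) * iv o * ((mh o - m o) * (F.piHat (X o) (D o) - piR Q o)) ∂Q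
      = ∫ o, (1 - eR Q o) * (mh o - m o) ∂Q + ∫ o, eR Q o * (iv o * (m o - mh o)) ∂Q := by
    rw [← integral_add hI1 hI2]
    refine integral_congr_ae (hO.eR_lt_one.mono fun o ho => ?_)
    have hp : F.piHat (X o) (D o) ≠ 0 := by
      intro h0; have := hreg.lower (X o) (D o); rw [h0] at this; simp at this; linarith
    have he : (1 - eR Q o) ≠ 0 := by linarith
    simp only [hiv, piR]
    field_simp
    ring
  have hI3 : ∫ o, (1 - eR Q o) * (mh o - m o) ∂Q
      = ∫ o, (1 - eR Q o) * mh o ∂Q - ∫ o, (1 - eR Q o) * m o ∂Q := by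
    rw [← integral_sub (heI' hmhi) (heI' hmi)]
    simp only [mul_sub]
  rw [hbias, hI3]
  ring

/-- If the mean moment at `η` is at least `-u`, the threshold `η` covers up to the two errors. -/
lemma Fit.Regular.le_coverage_of_le_integral_psi {m₀ π₀ : ℝ} (hreg : F.Regular m₀ π₀)
    (hF : MeasurableFit fun _ : Unit => F) (hπ : 0 < π₀) (hM : MissingAtRandom Q)
    (hO : Overlap Q) {γ η u : ℝ} (hu : -u ≤ ∫ o, F.psi γ η o ∂Q) :
    ENNReal.ofReal (1 - γ) ≤ F.coverage Q η + ENNReal.ofReal (u / probAttrition Q)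
      + F.productError Q 1 π₀ := by
  have hp := hO.probAttrition_pos
  set bias := ∫ o, (1 - eR Q o) * (F.piHat (X o) (D o))⁻¹
          * ((F.mHat η (X o) (D o) - F.mC Q η o) * (F.piHat (X o) (D o) - piR Q o)) ∂Q with hbias
  have h1 := hreg.integral_psi hF hπ hM hO γ η
  rw [← hbias] at h1
  have h2 := hreg.ofReal_abs_bias_le hF hπ hO η
  rw [← hbias] at h2
  have hcov : F.coverage Q η = ENNReal.ofReal
      (Q.real ({o | F.score o < η} ∩ {o | R o = false}) / probAttrition Q) := by
    unfold Fit.coverage attrited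
    simp only [EReal.coe_lt_coe_iff]
    rw [cond_apply (measurableSet_R false), Set.inter_comm, ← ofReal_measureReal (s := _ ∩ _),
      probAttrition, div_eq_inv_mul, ENNReal.ofReal_mul (inv_nonneg.2 measureReal_nonneg),
      ENNReal.ofReal_inv_of_pos (x := Q.real {o : Obs k | R o = false}) hp,
      ofReal_measureReal (s := {o | R o = false})]
  have hle : 1 - γ ≤ Q.real ({o | F.score o < η} ∩ {o | R o = false}) / probAttrition Q
      + u / probAttrition Q + |bias| / probAttrition Q := by
    rw [← add_div, ← add_div, le_div_iff₀ hp]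
    linarith [le_abs_self bias]
  refine (ENNReal.ofReal_le_ofReal hle).trans (ENNReal.ofReal_add_le.trans
    (add_le_add (ENNReal.ofReal_add_le.trans (by rw [hcov])) ?_))
  unfold Fit.productError
  rw [one_mul, div_eq_mul_inv, div_eq_mul_inv, mul_comm π₀⁻¹, mul_comm |bias|,
    ENNReal.ofReal_mul (inv_nonneg.2 hp.le), ENNReal.ofReal_mul (inv_nonneg.2 hp.le), mul_assoc]
  exact mul_le_mul' le_rfl h2

end Identification

/-! ### The infimum threshold and limits from above -/

section Threshold

variable {k : ℕ} {F : Fit k} {Q : Measure (Obs k)}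

/-- A sequence of reals that decreases strictly to the threshold `e < ∞`. -/
noncomputable def approachAbove (n : ℕ) (e : EReal) : ℝ :=
  if e = ⊥ then -(n : ℝ) else e.toReal + 1 / ((n : ℝ) + 1)

lemma measurable_approachAbove (n : ℕ) : Measurable (approachAbove n) :=
  Measurable.ite (measurableSet_singleton ⊥) measurable_const
    (measurable_ereal_toReal.add_const _)

lemma antitone_approachAbove (e : EReal) : Antitone fun n => approachAbove n e := by
  intro n m h
  have h' : (n : ℝ) ≤ m := Nat.cast_le.2 h
  simp only [approachAbove]
  split_ifs
  · linarith
  · gcongr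

lemma tendsto_approachAbove_bot : Tendsto (fun n => approachAbove n ⊥) atTop atBot := by
  simp only [approachAbove, if_true]
  exact tendsto_neg_atTop_atBot.comp tendsto_natCast_atTop_atTop

lemma tendsto_approachAbove_coe (x : ℝ) :
    Tendsto (fun n => approachAbove n (x : EReal)) atTop (𝓝[>] x) := by
  simp only [approachAbove, EReal.coe_ne_bot, if_false, EReal.toReal_coe]
  refine tendsto_nhdsWithin_iff.2 ⟨?_, Eventually.of_forall fun n => ?_⟩
  · simpa using tendsto_one_div_add_atTop_nhds_zero_nat.const_add x
  · have : (0 : ℝ) < 1 / ((n : ℝ) + 1) := by positivity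
    simpa using this

lemma forall_lt_approachAbove_iff {e : EReal} (he : e ≠ ⊤) (v : ℝ) :
    (∀ n, v < approachAbove n e) ↔ (v : EReal) ≤ e := by
  induction e with
  | bot =>
    simp only [approachAbove, if_true, le_bot_iff, EReal.coe_ne_bot, iff_false, not_forall, not_lt]
    obtain ⟨n, hn⟩ := exists_nat_ge (-v)
    exact ⟨n, by linarith⟩
  | coe x =>
    simp only [approachAbove, EReal.coe_ne_bot, if_false, EReal.toReal_coe, EReal.coe_le_coe_iff]
    constructor
    · intro h
      refine le_of_forall_pos_le_add fun ε hε => ?_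
      obtain ⟨n, hn⟩ := exists_nat_one_div_lt hε
      linarith [h n]
    · intro h n
      have : (0 : ℝ) < 1 / ((n : ℝ) + 1) := by positivity
      linarith
  | top => exact absurd rfl he

/-- `P(V_C ≤ e | R = 0)`. -/
noncomputable def Fit.closedCoverage (F : Fit k) (Q : Measure (Obs k)) (e : EReal) : ℝ≥0∞ :=
  attrited Q {o | (F.score o : EReal) ≤ e}

lemma Fit.coverage_le_closedCoverage (e : EReal) : F.coverage Q e ≤ F.closedCoverage Q e :=
  measure_mono fun o (h : (F.score o : EReal) < e) => (h.le : (F.score o : EReal) ≤ e)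

/-- Both endpoints of the expanded interval are included, so V ≤ e, without strictness, is enough.
-/
lemma Fit.closedCoverage_le_containment (e : EReal) :
    F.closedCoverage Q e ≤ F.containment Q e := by
  refine measure_mono fun o h y hy => ?_
  have h1 : F.hL (X o) - y ≤ F.score o := le_trans (by linarith [hy.1]) (le_max_left _ _)
  have h2 : y - F.hR (X o) ≤ F.score o := le_trans (by linarith [hy.2]) (le_max_right _ _)
  exact ⟨(EReal.coe_le_coe_iff.2 h1).trans h, (EReal.coe_le_coe_iff.2 h2).trans h⟩

lemma Fit.containment_le_add_surrogateMiss (e : EReal) :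
    F.containment Q e ≤ F.iteCoverage Q e + F.surrogateMiss Q := by
  refine (measure_mono fun o h => ?_).trans (measure_union_le _ _)
  by_cases ho : effect o ∈ F.surrogate o
  · exact Or.inl (h ho)
  · exact Or.inr ho

lemma Fit.Atomless.closedCoverage_le (hA : F.Atomless Q) (e : EReal) :
    F.closedCoverage Q e ≤ F.coverage Q e := by
  induction e with
  | bot => simp [Fit.closedCoverage]
  | coe x =>
    have hsub : {o | (F.score o : EReal) ≤ (x : EReal)}
        ⊆ {o | (F.score o : EReal) < (x : EReal)} ∪ {o | F.score o = x} := by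
      intro o (h : (F.score o : EReal) ≤ (x : EReal))
      rcases h.lt_or_eq with h | h
      · exact Or.inl h
      · exact Or.inr (EReal.coe_eq_coe_iff.1 h)
    refine (measure_mono hsub).trans ((measure_union_le _ _).trans ?_)
    rw [hA x, add_zero]
    exact le_rfl
  | top => exact measure_mono fun o _ => EReal.coe_lt_top _

/-- Uniformity in η is what permits a solution chosen from the same sample. -/
lemma Fit.neg_le_integral_psi_of_mem_solutions {γ u : ℝ} {N : ℕ} (hN : 0 < N)
    {s : Fin N → Obs k}
    (hs : ∀ η, |∑ i, (F.psi γ η (s i) - ∫ o, F.psi γ η o ∂Q)| ≤ N * u) {η : ℝ}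
    (hη : η ∈ F.solutions γ s) : -u ≤ ∫ o, F.psi γ η o ∂Q := by
  have hNr : (0 : ℝ) < N := Nat.cast_pos.2 hN
  have h1 : 0 ≤ (1 / (N : ℝ)) * ∑ i, F.psi γ η (s i) := hη
  have h2 : 0 ≤ ∑ i, F.psi γ η (s i) := by
    have h := mul_nonneg hNr.le h1
    rwa [← mul_assoc, mul_one_div_cancel hNr.ne', one_mul] at h
  have h3 := (abs_le.1 (hs η)).2
  rw [Finset.sum_sub_distrib] at h3
  simp only [Finset.sum_const, Finset.card_univ, Fintype.card_fin, nsmul_eq_mul] at h3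
  have h4 : 0 ≤ (N : ℝ) * (u + ∫ o, F.psi γ η o ∂Q) := by linarith
  linarith [nonneg_of_mul_nonneg_right h4 hNr]

variable [IsProbabilityMeasure Q]

lemma Overlap.isProbabilityMeasure_attrited (hO : Overlap Q) :
    IsProbabilityMeasure (attrited Q) := by
  refine cond_isProbabilityMeasure fun h0 => ?_
  have hp := hO.probAttrition_pos
  rw [probAttrition, measureReal_def, h0] at hp
  simp at hp

/-- The events {V < η} decrease to {V ≤ e} as η decreases to e: the strict inequality is lost in the
limit. -/
lemma Fit.tendsto_coverage (hF : MeasurableFit fun _ : Unit => F) (hO : Overlap Q) {e : EReal}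
    (he : e ≠ ⊤) :
    Tendsto (fun n => F.coverage Q (approachAbove n e)) atTop (𝓝 (F.closedCoverage Q e)) := by
  have := hO.isProbabilityMeasure_attrited
  have hset : {o | (F.score o : EReal) ≤ e}
      = ⋂ n, {o | (F.score o : EReal) < (approachAbove n e : ℝ)} := by
    ext o
    simp only [Set.mem_iInter]
    exact ((forall_lt_approachAbove_iff he _).symm).trans
      (forall_congr' fun n => EReal.coe_lt_coe_iff.symm)
  unfold Fit.closedCoverage
  rw [hset]
  refine tendsto_measure_iInter_atTop (fun n => ?_) (fun n m h o ho => ?_)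
    ⟨0, measure_ne_top _ _⟩
  · have hm : MeasurableSet {o | F.score o < approachAbove n e} :=
      measurableSet_lt (Fit.measurable_score hF) measurable_const
    simpa only [EReal.coe_lt_coe_iff] using hm.nullMeasurableSet
  · exact lt_of_lt_of_le ho (EReal.coe_le_coe_iff.2 (antitone_approachAbove e h))

/-- The mean moment need not be monotone, but it is a signed combination of bounded monotone
functions, so it has every limit that these all have. The filter is kept abstract to treat limits
from the right and at −∞ together. -/
lemma Fit.Regular.exists_tendsto_integral_psi {m₀ π₀ : ℝ} (hreg : F.Regular m₀ π₀)
    (hF : MeasurableFit fun _ : Unit => F) (hπ : 0 < π₀) (hπ1 : π₀ ≤ 1) {γ : ℝ} (hγ0 : 0 < γ)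
    (hγ1 : γ < 1) {l : Filter ℝ}
    (hl : ∀ M : ℝ → ℝ, Monotone M → (∀ η, M η ∈ Set.Icc (0 : ℝ) 1) → ∃ c, Tendsto M l (𝓝 c)) :
    ∃ c, Tendsto (fun η => ∫ o, F.psi γ η o ∂Q) l (𝓝 c) := by
  have hm0 := hreg.nonneg
  set B := 2 * (π₀⁻¹ * (1 + m₀)) with hBdef
  have hB : 0 < B := by positivity
  have h01 := hreg.component_mem_Icc hπ hπ1 hγ0 hγ1
  have hint : ∀ r η, Integrable (F.component γ m₀ B r η) Q := fun r η =>
    integrable_of_mem_Icc_zero_one (Fit.measurable_component hF _ _ _ r η) (h01 r η)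
  have hex : ∀ r, ∃ c, Tendsto (fun η => ∫ o, F.component γ m₀ B r η o ∂Q) l (𝓝 c) := fun r =>
    hl _ (fun a b hab => integral_mono (hint r a) (hint r b) (hreg.monotone_component hB r hab))
      fun η => integral_mem_Icc_zero_one (Fit.measurable_component hF _ _ _ r η) (h01 r η)
  choose c hc using hex
  refine ⟨-(B / 2) + B * ∑ r, componentSign r * c r, ?_⟩
  have heq : (fun η => ∫ o, F.psi γ η o ∂Q) = fun η =>
      -(B / 2) + B * ∑ r, componentSign r * ∫ o, F.component γ m₀ B r η o ∂Q := by
    ext η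
    simp_rw [F.psi_eq_sum_component hB.ne' γ m₀ η]
    rw [integral_add (integrable_const _)
      ((integrable_finsetSum _ fun r _ => (hint r η).const_mul _).const_mul _),
      integral_const_mul, integral_finsetSum _ fun r _ => (hint r η).const_mul _]
    simp [integral_const_mul]
  rw [heq]
  exact ((tendsto_finsetSum _ fun r _ => (hc r).const_mul _).const_mul _).const_add _

lemma exists_tendsto_nhdsGT (x : ℝ) (M : ℝ → ℝ) (hM : Monotone M)
    (_ : ∀ η, M η ∈ Set.Icc (0 : ℝ) 1) : ∃ c, Tendsto M (𝓝[>] x) (𝓝 c) :=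
  ⟨_, hM.tendsto_nhdsGT x⟩

lemma exists_tendsto_atBot (M : ℝ → ℝ) (hM : Monotone M)
    (h : ∀ η, M η ∈ Set.Icc (0 : ℝ) 1) : ∃ c, Tendsto M atBot (𝓝 c) :=
  ⟨_, tendsto_atBot_ciInf hM ⟨0, by rintro _ ⟨η, rfl⟩; exact (h η).1⟩⟩

/-- The filter of reals approaching the threshold `e < ∞` strictly from above. -/
noncomputable def filterAbove (e : EReal) : Filter ℝ := if e = ⊥ then atBot else 𝓝[>] e.toReal

lemma tendsto_approachAbove {e : EReal} (he : e ≠ ⊤) :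
    Tendsto (fun n => approachAbove n e) atTop (filterAbove e) := by
  induction e with
  | bot => simpa [filterAbove] using tendsto_approachAbove_bot
  | coe x => simpa [filterAbove] using tendsto_approachAbove_coe x
  | top => exact absurd rfl he

lemma Fit.Regular.exists_tendsto_filterAbove {m₀ π₀ : ℝ} (hreg : F.Regular m₀ π₀)
    (hF : MeasurableFit fun _ : Unit => F) (hπ : 0 < π₀) (hπ1 : π₀ ≤ 1) {γ : ℝ} (hγ0 : 0 < γ)
    (hγ1 : γ < 1) (e : EReal) :
    ∃ c, Tendsto (fun η => ∫ o, F.psi γ η o ∂Q) (filterAbove e) (𝓝 c) := by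
  refine hreg.exists_tendsto_integral_psi hF hπ hπ1 hγ0 hγ1 fun M hM h => ?_
  unfold filterAbove
  split_ifs
  · exact exists_tendsto_atBot M hM h
  · exact exists_tendsto_nhdsGT _ M hM h

/-- The mean moment just above the threshold `e`. -/
noncomputable def Fit.momentAbove (F : Fit k) (Q : Measure (Obs k)) (γ : ℝ) (e : EReal) : ℝ :=
  limsup (fun n => ∫ o, F.psi γ (approachAbove n e) o ∂Q) atTop

/-- `momentAbove` is a limsup along a sequence so that it is measurable in the data; as the full
limit exists, the two agree. -/
lemma Fit.Regular.tendsto_momentAbove {m₀ π₀ : ℝ} (hreg : F.Regular m₀ π₀)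
    (hF : MeasurableFit fun _ : Unit => F) (hπ : 0 < π₀) (hπ1 : π₀ ≤ 1) {γ : ℝ} (hγ0 : 0 < γ)
    (hγ1 : γ < 1) {e : EReal} (he : e ≠ ⊤) :
    Tendsto (fun η => ∫ o, F.psi γ η o ∂Q) (filterAbove e) (𝓝 (F.momentAbove Q γ e)) := by
  obtain ⟨c, hc⟩ := hreg.exists_tendsto_filterAbove (Q := Q) hF hπ hπ1 hγ0 hγ1 e
  have h : F.momentAbove Q γ e = c := (hc.comp (tendsto_approachAbove he)).limsup_eq
  rwa [h]

/-- An infimum that is not a member is approached by members strictly above it. The value ⊥ is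
listed apart because its `toReal` is the meaningless 0. -/
lemma Fit.frequently_mem_solutions {γ : ℝ} {N : ℕ} {s : Fin N → Obs k}
    (he : F.etaHat γ s ≠ ⊤)
    (hnot : F.etaHat γ s = ⊥ ∨ (F.etaHat γ s).toReal ∉ F.solutions γ s) :
    ∃ᶠ η in filterAbove (F.etaHat γ s), η ∈ F.solutions γ s := by
  set S := F.solutions γ s with hS
  have hlb : ∀ b : EReal, F.etaHat γ s < b → ∃ η ∈ S, ((η : ℝ) : EReal) < b := fun b hb => by
    obtain ⟨_, ⟨η, hη, rfl⟩, h⟩ := sInf_lt_iff.1 hb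
    exact ⟨η, hη, h⟩
  have hle : ∀ η ∈ S, F.etaHat γ s ≤ (η : EReal) := fun η hη => sInf_le ⟨η, hη, rfl⟩
  generalize F.etaHat γ s = e at *
  induction e with
  | bot =>
    simp only [filterAbove, if_true]
    refine frequently_atBot.2 fun a => ?_
    obtain ⟨η, hη, h⟩ := hlb a (EReal.bot_lt_coe a)
    exact ⟨η, (EReal.coe_lt_coe_iff.1 h).le, hη⟩
  | coe x =>
    simp only [filterAbove, EReal.coe_ne_bot, if_false, EReal.toReal_coe, false_or] at hnot ⊢
    refine (nhdsGT_basis x).frequently_iff.2 fun {b} hb => ?_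
    obtain ⟨η, hη, h⟩ := hlb b (EReal.coe_lt_coe_iff.2 hb)
    have hx := EReal.coe_le_coe_iff.1 (hle η hη)
    refine ⟨η, ⟨lt_of_le_of_ne hx ?_, EReal.coe_lt_coe_iff.1 h⟩, hη⟩
    rintro rfl
    exact hnot hη
  | top => exact absurd rfl he

lemma Fit.Attained.etaHat_toReal_mem {γ : ℝ} {N : ℕ} {s : Fin N → Obs k}
    (h : F.Attained γ s) :
    ∃ η : ℝ, F.etaHat γ s = η ∧ η ∈ F.solutions γ s := by
  obtain ⟨η, hη⟩ := h
  refine ⟨η, IsLeast.csInf_eq ⟨⟨η, hη.1, rfl⟩, ?_⟩, hη.1⟩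
  rintro _ ⟨x, hx, rfl⟩
  exact EReal.coe_le_coe_iff.2 (hη.2 hx)

/-- Coverage at a threshold at which, or just above which, the mean moment is nearly
nonnegative. -/
lemma Fit.Regular.le_closedCoverage {m₀ π₀ : ℝ} (hreg : F.Regular m₀ π₀)
    (hF : MeasurableFit fun _ : Unit => F) (hπ : 0 < π₀) (hπ1 : π₀ ≤ 1)
    (hM : MissingAtRandom Q) (hO : Overlap Q) {γ : ℝ} (hγ0 : 0 < γ) (hγ1 : γ < 1) {u : ℝ}
    {e : EReal} (h : ¬ (e ≠ ⊤ ∧ (e = ⊥ ∨ ∫ o, F.psi γ e.toReal o ∂Q < -u)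
      ∧ F.momentAbove Q γ e < -u)) :
    ENNReal.ofReal (1 - γ) ≤ F.closedCoverage Q e + ENNReal.ofReal (u / probAttrition Q)
      + F.productError Q 1 π₀ := by
  have hP := hO.isProbabilityMeasure_attrited
  -- No solution at all: the interval is the whole line and covers with probability one.
  by_cases he : e = ⊤
  · have h1 : F.closedCoverage Q e = 1 := by simp [Fit.closedCoverage, he]
    rw [h1, add_assoc]
    exact (ENNReal.ofReal_le_one.2 (by linarith)).trans le_self_add
  by_cases hx : e ≠ ⊥ ∧ -u ≤ ∫ o, F.psi γ e.toReal o ∂Q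
  · have h1 := hreg.le_coverage_of_le_integral_psi hF hπ hM hO hx.2
    rw [EReal.coe_toReal he hx.1] at h1
    refine h1.trans ?_
    gcongr
    exact F.coverage_le_closedCoverage e
  have hmom : -u ≤ F.momentAbove Q γ e := by
    by_contra hcon
    refine h ⟨he, ?_, not_le.1 hcon⟩
    by_contra hcon2
    push Not at hcon2
    exact hx hcon2
  have hlim := (hreg.tendsto_momentAbove (Q := Q) hF hπ hπ1 hγ0 hγ1 he).comp
    (tendsto_approachAbove he)
  -- At each η the slack u is taken to be exactly minus the mean moment, so that the inequality can
  -- pass to the limit.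
  have h2 : ∀ n, ENNReal.ofReal (1 - γ) ≤ F.coverage Q (approachAbove n e)
      + ENNReal.ofReal (-(∫ o, F.psi γ (approachAbove n e) o ∂Q) / probAttrition Q)
      + F.productError Q 1 π₀ := fun n =>
    hreg.le_coverage_of_le_integral_psi hF hπ hM hO (by rw [neg_neg])
  have h3 : ENNReal.ofReal (1 - γ) ≤ F.closedCoverage Q e
      + ENNReal.ofReal (-(F.momentAbove Q γ e) / probAttrition Q) + F.productError Q 1 π₀ :=
    ge_of_tendsto' (((Fit.tendsto_coverage hF hO he).add
      (ENNReal.tendsto_ofReal (hlim.neg.div_const _))).add_const _) h2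
  refine h3.trans ?_
  have hp := hO.probAttrition_pos
  gcongr
  linarith

end Threshold

/-! ### Finite-sample guarantees -/

section FiniteSample

lemma samplingError_eq_bandWidth_div {k : ℕ} {Q : Measure (Obs k)} {N : ℕ} {m₀ π₀ δ : ℝ} :
    samplingError Q 120 m₀ π₀ δ N = bandWidth m₀ π₀ δ N / probAttrition Q := by
  unfold samplingError bandWidth; ring

variable {k : ℕ} {Q : Measure (Obs k)} [IsProbabilityMeasure Q] {𝒯 : Type*} [MeasurableSpace 𝒯]
  {τ : Measure 𝒯} [IsProbabilityMeasure τ] {L : 𝒯 → Fit k} {N : ℕ} {γ m₀ π₀ δ : ℝ}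

instance : IsProbabilityMeasure (dataLaw τ Q N) := by unfold dataLaw; infer_instance

lemma MeasurableFit.measurable_integral_psi (hL : MeasurableFit L) (γ : ℝ) :
    Measurable fun p : 𝒯 × ℝ => ∫ o, (L p.1).psi γ p.2 o ∂Q :=
  (hL.measurable_psi γ).stronglyMeasurable.integral_prod_right.measurable

lemma MeasurableFit.measurable_integral_psi_comp (hL : MeasurableFit L) (γ : ℝ) {α : Type*}
    [MeasurableSpace α] {t : α → 𝒯} {η : α → ℝ} (ht : Measurable t) (hη : Measurable η) :
    Measurable fun a => ∫ o, (L (t a)).psi γ (η a) o ∂Q :=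
  (hL.measurable_integral_psi γ).comp (ht.prodMk hη)

/-- A measurable event has small probability if almost all of its sections are contained, up to a
null set, in the event that the sample moments deviate from their means. -/
lemma dataLaw_le_of_ae_section {W : Set (𝒯 × (Fin N → Obs k))} (hW : MeasurableSet W)
    (hL : MeasurableFit L) (hreg : ∀ t, (L t).Regular m₀ π₀) (hπ : 0 < π₀) (hπ1 : π₀ ≤ 1)
    (hγ0 : 0 < γ) (hγ1 : γ < 1) (hN : 0 < N) (hδ : 0 < δ) (hδ1 : δ ≤ 1)
    (h : ∀ᵐ t ∂τ, ∀ᵐ s ∂(Measure.pi fun _ : Fin N => Q), (t, s) ∈ W →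
      ∃ η, N * bandWidth m₀ π₀ δ N
        < |∑ i, ((L t).psi γ η (s i) - ∫ o, (L t).psi γ η o ∂Q)|) :
    dataLaw τ Q N W ≤ ENNReal.ofReal δ := by
  unfold dataLaw
  -- Only `W` must be measurable here; the deviation event is an uncountable union and enters
  -- through its outer measure on each section.
  rw [Measure.prod_apply hW]
  refine (lintegral_mono_ae (g := fun _ => ENNReal.ofReal δ) ?_).trans (by simp)
  filter_upwards [h] with t ht
  exact (measure_mono_ae ht).trans
    ((hreg t).pi_exists_deviation_le (hL.fixed t) hπ hπ1 hγ0 hγ1 Q hN hδ hδ1)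

/-- The failure event sits inside a measurable event `W` about the mean moment at and just above η̂.
Uniform closeness of the sample moments excludes `W`: either η̂ is a solution, or solutions
accumulate at it and the bound −u passes to the limit. -/
lemma dataLaw_closedCoverage_le (hM : MissingAtRandom Q) (hO : Overlap Q) (hL : MeasurableFit L)
    (hreg : ∀ t, (L t).Regular m₀ π₀) (hπ : 0 < π₀) (hπ1 : π₀ ≤ 1) (hγ0 : 0 < γ) (hγ1 : γ < 1)
    (hN : 0 < N)
    (hη : Measurable fun p : 𝒯 × (Fin N → Obs k) => (L p.1).etaHat γ p.2) (hδ : 0 < δ) :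
    dataLaw τ Q N {p | ¬ (ENNReal.ofReal (1 - γ) ≤
        (L p.1).closedCoverage Q ((L p.1).etaHat γ p.2)
          + ENNReal.ofReal (samplingError Q 120 m₀ π₀ δ N)
          + (L p.1).productError Q 1 π₀)} ≤ ENNReal.ofReal δ := by
  -- For δ ≥ 1 the claim is trivial; otherwise log(1/δ) ≥ 0.
  rcases le_total 1 δ with hδ1 | hδ1
  · exact prob_le_one.trans (ENNReal.one_le_ofReal.2 hδ1)
  set u := bandWidth m₀ π₀ δ N with hu
  set W : Set (𝒯 × (Fin N → Obs k)) := {p | (L p.1).etaHat γ p.2 ≠ ⊤ ∧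
    ((L p.1).etaHat γ p.2 = ⊥
      ∨ ∫ o, (L p.1).psi γ ((L p.1).etaHat γ p.2).toReal o ∂Q < -u)
    ∧ (L p.1).momentAbove Q γ ((L p.1).etaHat γ p.2) < -u} with hWdef
  have hW : MeasurableSet W := by
    have h1 : MeasurableSet {p : 𝒯 × (Fin N → Obs k) | (L p.1).etaHat γ p.2 ≠ ⊤} :=
      hη (measurableSet_singleton ⊤).compl
    have h2 : MeasurableSet {p : 𝒯 × (Fin N → Obs k) | (L p.1).etaHat γ p.2 = ⊥} :=
      hη (measurableSet_singleton ⊥)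
    have h3 : Measurable fun p : 𝒯 × (Fin N → Obs k) =>
        ∫ o, (L p.1).psi γ ((L p.1).etaHat γ p.2).toReal o ∂Q :=
      hL.measurable_integral_psi_comp γ measurable_fst (measurable_ereal_toReal.comp hη)
    have h4 : Measurable fun p : 𝒯 × (Fin N → Obs k) =>
        (L p.1).momentAbove Q γ ((L p.1).etaHat γ p.2) :=
      Measurable.limsup fun n => hL.measurable_integral_psi_comp γ measurable_fst
        ((measurable_approachAbove n).comp hη)
    exact h1.inter ((h2.union (measurableSet_lt h3 measurable_const)).inter
      (measurableSet_lt h4 measurable_const))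
  refine (measure_mono (t := W) fun p hp => ?_).trans
    (dataLaw_le_of_ae_section hW hL hreg hπ hπ1 hγ0 hγ1 hN hδ hδ1
      (ae_of_all _ fun t => ae_of_all _ fun s hs => ?_))
  · by_contra hcon
    refine hp ?_
    rw [samplingError_eq_bandWidth_div]
    exact (hreg p.1).le_closedCoverage (hL.fixed p.1) hπ hπ1 hM hO hγ0 hγ1 hcon
  · by_contra hcon
    push Not at hcon
    obtain ⟨htop, hx, hlim⟩ := hs
    have hsol : ∀ η ∈ (L t).solutions γ s, -u ≤ ∫ o, (L t).psi γ η o ∂Q := fun η =>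
      Fit.neg_le_integral_psi_of_mem_solutions hN hcon
    refine absurd hlim (not_lt.2 ?_)
    have hfreq := Fit.frequently_mem_solutions htop
      (hx.imp_right fun h hmem => absurd h (not_lt.2 (hsol _ hmem)))
    exact ge_of_tendsto_of_frequently
      ((hreg t).tendsto_momentAbove (hL.fixed t) hπ hπ1 hγ0 hγ1 htop) (hfreq.mono hsol)

/-- If η̂ is attained, it is itself a solution and no limit is needed. Without atoms, closed and
open coverage coincide. -/
lemma dataLaw_coverage_le (hM : MissingAtRandom Q) (hO : Overlap Q) (hL : MeasurableFit L)
    (hreg : ∀ t, (L t).Regular m₀ π₀) (hπ : 0 < π₀) (hπ1 : π₀ ≤ 1) (hγ0 : 0 < γ) (hγ1 : γ < 1)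
    (hN : 0 < N)
    (hη : Measurable fun p : 𝒯 × (Fin N → Obs k) => (L p.1).etaHat γ p.2) (hδ : 0 < δ)
    (h : (∀ᵐ p ∂(dataLaw τ Q N), (L p.1).Attained γ p.2) ∨ (∀ᵐ t ∂τ, (L t).Atomless Q)) :
    dataLaw τ Q N {p | ¬ (ENNReal.ofReal (1 - γ) ≤
        (L p.1).coverage Q ((L p.1).etaHat γ p.2)
          + ENNReal.ofReal (samplingError Q 120 m₀ π₀ δ N)
          + (L p.1).productError Q 1 π₀)} ≤ ENNReal.ofReal δ := by
  rcases h with hatt | hatom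
  · rcases le_total 1 δ with hδ1 | hδ1
    · exact prob_le_one.trans (ENNReal.one_le_ofReal.2 hδ1)
    set u := bandWidth m₀ π₀ δ N with hu
    set W : Set (𝒯 × (Fin N → Obs k)) :=
      {p | ∫ o, (L p.1).psi γ ((L p.1).etaHat γ p.2).toReal o ∂Q < -u} with hWdef
    have hW : MeasurableSet W := measurableSet_lt
      (hL.measurable_integral_psi_comp γ measurable_fst (measurable_ereal_toReal.comp hη))
      measurable_const
    have hsec : ∀ᵐ t ∂τ, ∀ᵐ s ∂(Measure.pi fun _ : Fin N => Q), (L t).Attained γ s :=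
      Measure.ae_ae_of_ae_prod hatt
    refine (measure_mono_ae ?_).trans
      (dataLaw_le_of_ae_section hW hL hreg hπ hπ1 hγ0 hγ1 hN hδ hδ1 ?_)
    · filter_upwards [hatt] with p hp hbad
      obtain ⟨η, he, -⟩ := hp.etaHat_toReal_mem
      by_contra hcon
      refine hbad ?_
      have hcon : -u ≤ ∫ o, (L p.1).psi γ ((L p.1).etaHat γ p.2).toReal o ∂Q := not_lt.1 hcon
      rw [he, EReal.toReal_coe] at hcon
      rw [samplingError_eq_bandWidth_div, he]
      exact (hreg p.1).le_coverage_of_le_integral_psi (hL.fixed p.1) hπ hM hO hcon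
    · filter_upwards [hsec] with t ht
      filter_upwards [ht] with s hs hmem
      obtain ⟨η, he, hsol⟩ := hs.etaHat_toReal_mem
      by_contra hcon
      push Not at hcon
      have h1 := Fit.neg_le_integral_psi_of_mem_solutions hN hcon hsol
      have hmem : ∫ o, (L t).psi γ ((L t).etaHat γ s).toReal o ∂Q < -u := hmem
      rw [he, EReal.toReal_coe] at hmem
      linarith
  · refine (measure_mono_ae ?_).trans
      (dataLaw_closedCoverage_le (τ := τ) hM hO hL hreg hπ hπ1 hγ0 hγ1 hN hη hδ)
    have hae : ∀ᵐ p ∂(dataLaw τ Q N), (L p.1).Atomless Q :=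
      Measure.quasiMeasurePreserving_fst.ae hatom
    filter_upwards [hae] with p hp hbad hgood
    refine hbad (hgood.trans ?_)
    gcongr
    exact hp.closedCoverage_le _

lemma dataLaw_containment_le (hM : MissingAtRandom Q) (hO : Overlap Q) (hL : MeasurableFit L)
    (hreg : ∀ t, (L t).Regular m₀ π₀) (hπ : 0 < π₀) (hπ1 : π₀ ≤ 1) (hγ0 : 0 < γ) (hγ1 : γ < 1)
    (hN : 0 < N)
    (hη : Measurable fun p : 𝒯 × (Fin N → Obs k) => (L p.1).etaHat γ p.2) (hδ : 0 < δ) :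
    dataLaw τ Q N {p | ¬ (ENNReal.ofReal (1 - γ) ≤
        (L p.1).containment Q ((L p.1).etaHat γ p.2)
          + ENNReal.ofReal (samplingError Q 120 m₀ π₀ δ N)
          + (L p.1).productError Q 1 π₀)} ≤ ENNReal.ofReal δ := by
  refine (measure_mono fun p hbad hgood => ?_).trans
    (dataLaw_closedCoverage_le (τ := τ) hM hO hL hreg hπ hπ1 hγ0 hγ1 hN hη hδ)
  refine hbad (hgood.trans ?_)
  gcongr
  exact Fit.closedCoverage_le_containment _

lemma dataLaw_iteCoverage_le (hM : MissingAtRandom Q) (hO : Overlap Q) (hL : MeasurableFit L)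
    (hreg : ∀ t, (L t).Regular m₀ π₀) (hπ : 0 < π₀) (hπ1 : π₀ ≤ 1) (hγ0 : 0 < γ) (hγ1 : γ < 1)
    (hN : 0 < N)
    (hη : Measurable fun p : 𝒯 × (Fin N → Obs k) => (L p.1).etaHat γ p.2) (hδ : 0 < δ) :
    dataLaw τ Q N {p | ¬ (1 ≤ (L p.1).iteCoverage Q ((L p.1).etaHat γ p.2)
          + ((L p.1).surrogateMiss Q + ENNReal.ofReal γ)
          + ENNReal.ofReal (samplingError Q 120 m₀ π₀ δ N)
          + (L p.1).productError Q 1 π₀)} ≤ ENNReal.ofReal δ := by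
  refine (measure_mono fun p hbad hgood => ?_).trans
    (dataLaw_containment_le (τ := τ) hM hO hL hreg hπ hπ1 hγ0 hγ1 hN hη hδ)
  refine hbad ?_
  have h1 : (1 : ℝ≥0∞) = ENNReal.ofReal (1 - γ) + ENNReal.ofReal γ := by
    rw [← ENNReal.ofReal_add (by linarith) hγ0.le]; simp
  rw [h1]
  refine (add_le_add_left hgood (ENNReal.ofReal γ)).trans ?_
  refine (add_le_add_left (add_le_add_left (add_le_add_left
    (Fit.containment_le_add_surrogateMiss _) _) _) _).trans (le_of_eq ?_)
  ring

end FiniteSample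

/-! ### Asymptotic coverage -/

section Asymptotics

lemma tendsto_samplingError {k : ℕ} (Q : Measure (Obs k)) (C₀ m₀ π₀ δ : ℝ) :
    Tendsto (samplingError Q C₀ m₀ π₀ δ) atTop (𝓝 0) := by
  have h1 : Tendsto (fun N : ℕ => Real.sqrt ((Real.log (1 / δ) + 1) / N)) atTop (𝓝 0) := by
    have h := (Real.continuous_sqrt.tendsto 0).comp
      (tendsto_const_div_atTop_nhds_zero_nat (Real.log (1 / δ) + 1))
    rw [Real.sqrt_zero] at h
    exact h
  have h2 := h1.const_mul (C₀ * (π₀⁻¹ * (1 + m₀) / probAttrition Q))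
  rw [mul_zero] at h2
  exact h2

/-- The tolerance is split in thirds among surrogate miss, sampling error and product error. The
probability is split in thirds among the finite-sample failure and the two events of convergence in
probability. -/
lemma tendsto_dataLaw_iteCoverage {k : ℕ} {Q : Measure (Obs k)} [IsProbabilityMeasure Q]
    (hM : MissingAtRandom Q) (hO : Overlap Q) {γ m₀ π₀ : ℝ} (hγ0 : 0 < γ) (hγ1 : γ < 1)
    (hπ : 0 < π₀) (hπ1 : π₀ ≤ 1) {𝒯 : ℕ → Type*} [∀ n, MeasurableSpace (𝒯 n)]
    {τ : ∀ n, Measure (𝒯 n)} [∀ n, IsProbabilityMeasure (τ n)] {L : ∀ n, 𝒯 n → Fit k}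
    {N : ℕ → ℕ} {α : ℝ} (hL : ∀ n, MeasurableFit (L n)) (hreg : ∀ n t, (L n t).Regular m₀ π₀)
    (hη : ∀ n, Measurable fun p : 𝒯 n × (Fin (N n) → Obs k) => (L n p.1).etaHat γ p.2)
    (hα : 0 < α) (hN : Tendsto N atTop atTop)
    (hmiss : ∀ ε : ℝ, 0 < ε → Tendsto (fun n =>
      τ n {t | ENNReal.ofReal (α + ε) < (L n t).surrogateMiss Q}) atTop (𝓝 0))
    (hprod : ∀ ε : ℝ, 0 < ε → Tendsto (fun n =>
      τ n {t | ENNReal.ofReal ε < (L n t).piError Q * (L n t).mError Q}) atTop (𝓝 0))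
    {ε : ℝ} (hε : 0 < ε) :
    Tendsto (fun n => dataLaw (τ n) Q (N n)
      {p | (L n p.1).iteCoverage Q ((L n p.1).etaHat γ p.2)
        < ENNReal.ofReal (1 - (α + γ) - ε)}) atTop (𝓝 0) := by
  have hp := hO.probAttrition_pos
  -- The level that the factor π₀⁻¹ / P(R = 0) in the product error turns into ε/3.
  have hκ : 0 < ε / 3 * (probAttrition Q * π₀) := by positivity
  rw [ENNReal.tendsto_nhds_zero]
  intro δ' hδ'
  have hδ3 : 0 < δ' / 3 := ENNReal.div_pos hδ'.ne' (by norm_num)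
  -- A finite δ is needed, whereas δ' may be ∞; fixing it first lets the sampling error vanish as N
  -- grows.
  obtain ⟨δ, hδ0, hδ⟩ := ENNReal.lt_iff_exists_nnreal_btwn.1 hδ3
  have hδpos : (0 : ℝ) < δ := by exact_mod_cast hδ0
  have hsamp := ((tendsto_samplingError Q 120 m₀ π₀ δ).comp hN).eventually
    (eventually_le_nhds (show (0 : ℝ) < ε / 3 by positivity))
  filter_upwards [ENNReal.tendsto_nhds_zero.1 (hmiss (ε / 3) (by positivity)) _ hδ3,
    ENNReal.tendsto_nhds_zero.1 (hprod _ hκ) _ hδ3, hsamp, hN.eventually_gt_atTop 0]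
    with n h1 h2 h3 h4
  have hfst : ∀ A : Set (𝒯 n), dataLaw (τ n) Q (N n) (A ×ˢ Set.univ) = τ n A := fun A => by
    simp [dataLaw]
  have hfin := dataLaw_iteCoverage_le (τ := τ n) hM hO (hL n) (hreg n) hπ hπ1 hγ0 hγ1 h4 (hη n)
    hδpos
  rw [ENNReal.ofReal_coe_nnreal] at hfin
  rw [← hfst] at h1 h2
  have hsum : δ' / 3 + δ' / 3 + δ' / 3 = δ' := ENNReal.add_thirds δ'
  rw [← hsum]
  refine (measure_mono ?_).trans ((measure_union_le _ _).trans (add_le_add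
    ((measure_union_le _ _).trans (add_le_add (hfin.trans hδ.le) h1)) h2))
  intro p (hlt : (L n p.1).iteCoverage Q ((L n p.1).etaHat γ p.2)
    < ENNReal.ofReal (1 - (α + γ) - ε))
  by_contra hcon
  simp only [Set.mem_union, Set.mem_prod, Set.mem_univ, and_true, not_or] at hcon
  obtain ⟨⟨hc1, hc2⟩, hc3⟩ := hcon
  have hc1 := not_not.1 hc1
  have hc2 : (L n p.1).surrogateMiss Q ≤ ENNReal.ofReal (α + ε / 3) := not_lt.1 hc2
  have hc3 : (L n p.1).piError Q * (L n p.1).mError Q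
      ≤ ENNReal.ofReal (ε / 3 * (probAttrition Q * π₀)) := not_lt.1 hc3
  have hc4 : (L n p.1).productError Q 1 π₀ ≤ ENNReal.ofReal (ε / 3) := by
    unfold Fit.productError
    refine (mul_le_mul' le_rfl hc3).trans ?_
    rw [← ENNReal.ofReal_mul (by positivity)]
    refine le_of_eq (congrArg _ ?_)
    field_simp
  refine absurd hlt (not_lt.2 ?_)
  -- The target may be negative; truncated subtraction in `ℝ≥0∞` handles both signs.
  have hq : 1 - (α + γ) - ε = 1 - (α + γ + ε) := by ring
  rw [hq, ENNReal.ofReal_sub _ (by positivity), ENNReal.ofReal_one, tsub_le_iff_right]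
  have hsplit : ENNReal.ofReal (α + γ + ε) = (ENNReal.ofReal (α + ε / 3) + ENNReal.ofReal γ)
      + ENNReal.ofReal (ε / 3) + ENNReal.ofReal (ε / 3) := by
    rw [← ENNReal.ofReal_add (by positivity) hγ0.le, ← ENNReal.ofReal_add (by positivity)
      (by positivity), ← ENNReal.ofReal_add (by positivity) (by positivity)]
    congr 1; ring
  rw [hsplit, ← add_assoc, ← add_assoc]
  refine le_trans hc1 ?_
  gcongr
  exact h3

end Asymptotics

end Attrition

open Attrition in
theorem theoremB1 :
    ∃ C₀ C₁ : ℝ, 0 < C₀ ∧ 0 < C₁ ∧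
      ∀ (k : ℕ) (Q : Measure (Obs k)) [IsProbabilityMeasure Q],
        Unconfounded Q → MissingAtRandom Q → Overlap Q →
      ∀ (γ m₀ π₀ : ℝ), 0 < γ → γ < 1 → 0 < π₀ → π₀ ≤ 1 →
        -- finite samples
        (∀ (𝒯 : Type*) [MeasurableSpace 𝒯] (τ : Measure 𝒯) [IsProbabilityMeasure τ]
            (L : 𝒯 → Fit k) (N : ℕ),
          MeasurableFit L → (∀ t, (L t).Regular m₀ π₀) → 0 < N →
          (Measurable fun p : 𝒯 × (Fin N → Obs k) => (L p.1).etaHat γ p.2) →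
          ∀ δ : ℝ, 0 < δ →
            (((∀ᵐ p ∂(dataLaw τ Q N), (L p.1).Attained γ p.2) ∨
                (∀ᵐ t ∂τ, (L t).Atomless Q)) →
              dataLaw τ Q N {p | ¬ (ENNReal.ofReal (1 - γ) ≤
                (L p.1).coverage Q ((L p.1).etaHat γ p.2)
                  + ENNReal.ofReal (samplingError Q C₀ m₀ π₀ δ N)
                  + (L p.1).productError Q C₁ π₀)} ≤ ENNReal.ofReal δ) ∧
            dataLaw τ Q N {p | ¬ (ENNReal.ofReal (1 - γ) ≤
                (L p.1).containment Q ((L p.1).etaHat γ p.2)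
                  + ENNReal.ofReal (samplingError Q C₀ m₀ π₀ δ N)
                  + (L p.1).productError Q C₁ π₀)} ≤ ENNReal.ofReal δ ∧
            dataLaw τ Q N {p | ¬ (1 ≤
                (L p.1).iteCoverage Q ((L p.1).etaHat γ p.2)
                  + ((L p.1).surrogateMiss Q + ENNReal.ofReal γ)
                  + ENNReal.ofReal (samplingError Q C₀ m₀ π₀ δ N)
                  + (L p.1).productError Q C₁ π₀)} ≤ ENNReal.ofReal δ) ∧
        -- asymptotic coverage of the individual treatment effect
        (∀ (𝒯 : ℕ → Type*) [∀ n, MeasurableSpace (𝒯 n)] (τ : ∀ n, Measure (𝒯 n))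
            [∀ n, IsProbabilityMeasure (τ n)] (L : ∀ n, 𝒯 n → Fit k) (N : ℕ → ℕ) (α : ℝ),
          (∀ n, MeasurableFit (L n)) → (∀ n t, (L n t).Regular m₀ π₀) →
          (∀ n, Measurable fun p : 𝒯 n × (Fin (N n) → Obs k) => (L n p.1).etaHat γ p.2) →
          0 < α → α < 1 →
          Tendsto N atTop atTop →
          (∀ ε : ℝ, 0 < ε → Tendsto (fun n =>
            τ n {t | ENNReal.ofReal (α + ε) < (L n t).surrogateMiss Q}) atTop (𝓝 0)) →
          (∀ ε : ℝ, 0 < ε → Tendsto (fun n =>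
            τ n {t | ENNReal.ofReal ε < (L n t).piError Q * (L n t).mError Q}) atTop (𝓝 0)) →
          ∀ ε : ℝ, 0 < ε → Tendsto (fun n =>
            dataLaw (τ n) Q (N n) {p | (L n p.1).iteCoverage Q ((L n p.1).etaHat γ p.2)
              < ENNReal.ofReal (1 - (α + γ) - ε)}) atTop (𝓝 0)) := by
  refine ⟨120, 1, by norm_num, one_pos, ?_⟩
  intro k Q _ _ hM hO γ m₀ π₀ hγ0 hγ1 hπ hπ1
  refine ⟨?_, ?_⟩
  · intro 𝒯 _ τ _ L N hL hreg hN hη δ hδ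
    exact ⟨dataLaw_coverage_le hM hO hL hreg hπ hπ1 hγ0 hγ1 hN hη hδ,
      dataLaw_containment_le hM hO hL hreg hπ hπ1 hγ0 hγ1 hN hη hδ,
      dataLaw_iteCoverage_le hM hO hL hreg hπ hπ1 hγ0 hγ1 hN hη hδ⟩
  · intro 𝒯 _ τ _ L N α hL hreg hη hα _ hN hmiss hprod ε hε
    exact tendsto_dataLaw_iteCoverage hM hO hγ0 hγ1 hπ hπ1 hL hreg hη hα hN hmiss hprod hε
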